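/- Let $(X,d,\mu)$ be a space of homogeneous type: $X\neq\emptyset$; $d:X\times X\to[0,\infty)$ is a quasi-metric, i.e. $d(x,y)=0$ iff $x=y$, $d(x,y)=d(y,x)$, and $d(x,y)\le A_0(d(x,z)+d(z,y))$ for some constant $A_0\ge1$; and $\mu$ is a regular measure (every measurable set has measure equal to the infimum of the measures of the open sets containing it) on the $\sigma$-algebra generated by the open sets and the balls $B(x,r)=\{y:d(x,y)<r\}$, with $0<\mu(B(x,2r))\le C_\mu\,\mu(B(x,r))<\infty$ for all $x\in X$, $r>0$ and some constant $C_\mu\ge 1$. Fix $x_0\in X$. Let $m\in\mathbb N$, $\eta\in[0,m)$, and let $p_1(\cdot),\dots,p_m(\cdot):X\to[1,\infty)$ be measurable with $1<\operatorname{ess\,inf}p_i\le\operatorname{ess\,sup}p_i<\infty$ and globally log-Hölder continuous: for each $i$ there are $C,p_{i,\infty}\in\mathbb R$ with $$|p_i(x)-p_i(y)|\le\frac{C}{\log(e+1/d(x,y))}\ \text{ whenever } 0<d(x,y)<\tfrac12,\qquad |p_i(x)-p_{i,\infty}|\le\frac{C}{\log(e+d(x,x_0))}\ \text{ for all }x\in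 X.$$ Let $\frac1{p(\cdot)}=\sum_{i=1}^m\frac1{p_i(\cdot)}$ and $\frac1{p(\cdot)}-\frac1{q(\cdot)}=\eta$, where $q(\cdot)$ is measurable with $0<\operatorname{ess\,inf}q\le\operatorname{ess\,sup}q<\infty$. For a measurable function $f$ put $\|f\|_{p(\cdot)}=\inf\{\lambda>0:\int_X(|f(x)|/\lambda)^{p(x)}\,d\mu\le1\}$, $\|f\|_{L^{p(\cdot)}(X,\omega)}=\|\omega f\|_{p(\cdot)}$ and $\|g\|_{WL^{q(\cdot)}(X,\omega)}=\sup_{t>0}\|t\,\omega\,\chi_{\{|g|>t\}}\|_{q(\cdot)}$ (if the set $\{|g|>t\}$ is not measurable, it is replaced by a measurable hull). Let $$\mathscr M_\eta(\vec f)(x)=\sup_{B\ni x}\mu(B)^{\eta}\prod_{i=1}^m\frac1{\mu(B)}\int_B|f_i|\,d\mu,$$ the supremum being over all balls $B$ containing $x$. A weight is a measurable function $X\to[0,\infty]$ that is integrable on every ball and satisfies $0<\omega<\infty$ a.e. For weights $\omega_1,\dots,\omega_m$ put $\omega=\prod_{i=1}^m\omega_i$, $\vec\omega=(\omega_1,\dots,\omega_m,\omega)$,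 and $$[\vec\omega]_{A_{\vec p(\cdot),q(\cdot)}(X)}=\sup_{B}\mu(B)^{\eta-m}\|\omega\chi_B\|_{q(\cdot)}\prod_{i=1}^m\|\omega_i^{-1}\chi_B\|_{p_i'(\cdot)},\qquad p_i'(\cdot)=\frac{p_i(\cdot)}{p_i(\cdot)-1},$$ the supremum being over all balls; $\vec\omega\in A_{\vec p(\cdot),q(\cdot)}(X)$ means that this is finite. Then for all weights $\omega_1,\dots,\omega_m$, the operator $\mathscr M_\eta$ is bounded from $L^{p_1(\cdot)}(X,\omega_1)\times\cdots\times L^{p_m(\cdot)}(X,\omega_m)$ to $WL^{q(\cdot)}(X,\omega)$ if and only if $\vec\omega\in A_{\vec p(\cdot),q(\cdot)}(X)$. Moreover, there is a constant $C>0$, independent of $\vec\omega$, such that for all weights $\omega_1,\dots,\omega_m$ $$[\vec\omega]_{A_{\vec p(\cdot),q(\cdot)}(X)}\le C\,\|\mathscr M_\eta\|_{\prod_{i=1}^mL^{p_i(\cdot)}(X,\omega_i)\to WL^{q(\cdot)}(X,\omega)},$$ where the operator norm is the least admissible constant ($\infty$ if $\mathscr M_\eta$ is not bounded), and this operator norm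 is finite whenever $\vec\omega\in A_{\vec p(\cdot),q(\cdot)}(X)$. -/

import Mathlib

open MeasureTheory
open scoped ENNReal NNReal

noncomputable section

namespace VarWeights

/-- A quasi-metric on `X`. -/
structure QuasiMetric (X : Type*) where
  toFun : X → X → ℝ
  nonneg : ∀ x y, 0 ≤ toFun x y
  eq_zero_iff : ∀ x y, toFun x y = 0 ↔ x = y
  symm : ∀ x y, toFun x y = toFun y x
  quasi_triangle : ∃ A₀ : ℝ, 1 ≤ A₀ ∧
    ∀ x y z, toFun x y ≤ A₀ * (toFun x z + toFun z y)

variable {X : Type*}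

instance : CoeFun (QuasiMetric X) (fun _ => X → X → ℝ) := ⟨QuasiMetric.toFun⟩

/-- The quasi-metric ball `B(x, r) = {y : d(x, y) < r}`. -/
def QuasiMetric.ball (d : QuasiMetric X) (x : X) (r : ℝ) : Set X := {y | d x y < r}

/-- The topology induced by a quasi-metric: `U` is open when each of its points is the centre of
a ball contained in `U`. (Balls themselves need not be open.) -/
@[reducible] def QuasiMetric.topology (d : QuasiMetric X) : TopologicalSpace X where
  IsOpen U := ∀ x ∈ U, ∃ r : ℝ, 0 < r ∧ d.ball x r ⊆ U
  isOpen_univ := fun _ _ => ⟨1, one_pos, Set.subset_univ _⟩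
  isOpen_inter := by
    rintro U V hU hV x ⟨hxU, hxV⟩
    obtain ⟨r, hr, hrU⟩ := hU x hxU
    obtain ⟨s, hs, hsV⟩ := hV x hxV
    refine ⟨min r s, lt_min hr hs, fun y hy => ⟨hrU ?_, hsV ?_⟩⟩
    · exact lt_of_lt_of_le hy (min_le_left r s)
    · exact lt_of_lt_of_le hy (min_le_right r s)
  isOpen_sUnion := by
    rintro S hS x ⟨U, hU, hxU⟩
    obtain ⟨r, hr, hrU⟩ := hS U hU x hxU
    exact ⟨r, hr, hrU.trans (Set.subset_sUnion_of_mem hU)⟩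

/-- The `σ`-algebra generated by the open sets and the quasi-metric balls. -/
@[reducible] def QuasiMetric.sigmaAlgebra (d : QuasiMetric X) : MeasurableSpace X :=
  MeasurableSpace.generateFrom
    ({U | d.topology.IsOpen U} ∪ {B | ∃ (x : X) (r : ℝ), 0 < r ∧ B = d.ball x r})

/-- `(X, d, μ)` is a space of homogeneous type: `μ` is a regular doubling measure on the
`σ`-algebra generated by the open sets and the balls. Of regularity only the approximation of
measurable sets from outside by open sets is required, so that `X` need not be complete. -/
structure IsHomogeneousType [mX : MeasurableSpace X] (d : QuasiMetric X) (μ : Measure X) :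
    Prop where
  measurableSpace_eq : mX = d.sigmaAlgebra
  outer_regular : ∀ E : Set X, MeasurableSet E →
    μ E = ⨅ (U : Set X) (_ : d.topology.IsOpen U) (_ : E ⊆ U), μ U
  doubling : ∃ Cμ : ℝ≥0, 1 ≤ Cμ ∧ ∀ (x : X) (r : ℝ), 0 < r →
    0 < μ (d.ball x (2 * r)) ∧ μ (d.ball x (2 * r)) ≤ Cμ * μ (d.ball x r) ∧
      μ (d.ball x r) < ∞

section Exponents

variable [MeasurableSpace X]

/-- The class `𝒫` : measurable `p : X → [1, ∞)` with `1 < p₋ ≤ p₊ < ∞`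
(essential infimum and supremum). -/
structure IsExpP (μ : Measure X) (p : X → ℝ) : Prop where
  measurable : Measurable p
  one_le : ∀ x, 1 ≤ p x
  one_lt_essInf : 1 < essInf (fun x => ENNReal.ofReal (p x)) μ
  essSup_lt_top : essSup (fun x => ENNReal.ofReal (p x)) μ < ∞

/-- The class `𝒫₀` : measurable `p : X → [0, ∞)` with `0 < p₋ ≤ p₊ < ∞`. -/
structure IsExpP0 (μ : Measure X) (p : X → ℝ) : Prop where
  measurable : Measurable p
  nonneg : ∀ x, 0 ≤ p x
  essInf_pos : 0 < essInf (fun x => ENNReal.ofReal (p x)) μ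
  essSup_lt_top : essSup (fun x => ENNReal.ofReal (p x)) μ < ∞

end Exponents

/-- Local log-Hölder continuity `LH₀`. -/
def LH0 (d : QuasiMetric X) (p : X → ℝ) : Prop :=
  ∃ C : ℝ, ∀ x y : X, d x y < 1 / 2 →
    |p x - p y| ≤ C / Real.log (Real.exp 1 + 1 / d x y)

/-- Log-Hölder continuity at infinity `LH_∞`, with respect to the point `x₀`. -/
def LHInfty (d : QuasiMetric X) (x₀ : X) (p : X → ℝ) : Prop :=
  ∃ pInf C : ℝ, ∀ x : X, |p x - pInf| ≤ C / Real.log (Real.exp 1 + d x x₀)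

/-- Global log-Hölder continuity `LH = LH₀ ∩ LH_∞`. -/
def LH (d : QuasiMetric X) (x₀ : X) (p : X → ℝ) : Prop := LH0 d p ∧ LHInfty d x₀ p

variable [MeasurableSpace X]

/-- The Luxemburg (quasi-)norm `‖f‖_{p(·)} = inf {r > 0 : ∫ (f / r)^{p(x)} dμ ≤ 1}` of a function
with values in `[0, ∞]`, for an exponent that is finite almost everywhere; it is `∞` if there is
no such `r`. The norm `‖f χ_E‖_{p(·)}` is obtained as `luxNorm (μ.restrict E) p f`; when `E` is not
measurable this is `‖f χ_F‖_{p(·)}` for a measurable hull `F` of `E`. -/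
def luxNorm (μ : Measure X) (p : X → ℝ) (f : X → ℝ≥0∞) : ℝ≥0∞ :=
  sInf {r : ℝ≥0∞ | 0 < r ∧ r ≠ ∞ ∧ ∫⁻ x, (f x / r) ^ p x ∂μ ≤ 1}

/-- The norm `‖f‖_{L^{p(·)}(X, ω)} = ‖ω f‖_{p(·)}`. -/
def wNorm (μ : Measure X) (p : X → ℝ) (ω : X → ℝ≥0∞) (f : X → ℝ) : ℝ≥0∞ :=
  luxNorm μ p (fun x => ω x * ‖f x‖ₑ)

/-- Membership in `L^{p(·)}(X, ω)`. -/
def MemWLp (μ : Measure X) (p : X → ℝ) (ω : X → ℝ≥0∞) (f : X → ℝ) : Prop :=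
  AEMeasurable f μ ∧ wNorm μ p ω f < ∞

/-- The weak norm `‖g‖_{WL^{q(·)}(X, ω)} = sup_{t > 0} ‖t ω χ_{{g > t}}‖_{q(·)}`
of a function with values in `[0, ∞]`. The function `g` is not required to be measurable (a maximal
function over quasi-metric balls need not be): superlevel sets are measured from outside. -/
def weakNorm (μ : Measure X) (q : X → ℝ) (ω : X → ℝ≥0∞) (g : X → ℝ≥0∞) : ℝ≥0∞ :=
  ⨆ (t : ℝ≥0) (_ : 0 < t),
    luxNorm (μ.restrict {x | (t : ℝ≥0∞) < g x}) q (fun x => t * ω x)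

/-- A weight: a function with values in `[0, ∞]`, integrable on every ball, with
`0 < ω < ∞` almost everywhere. -/
structure IsWeight (d : QuasiMetric X) (μ : Measure X) (ω : X → ℝ≥0∞) : Prop where
  aemeasurable : AEMeasurable ω μ
  locally_integrable : ∀ (x : X) (r : ℝ), 0 < r → ∫⁻ y in d.ball x r, ω y ∂μ < ∞
  pos_finite : ∀ᵐ x ∂μ, 0 < ω x ∧ ω x < ∞

variable {m : ℕ}

/-- The multilinear fractional average `μ(B)^η ∏ᵢ ⟨|fᵢ|⟩_B` over a set `B`. -/
def fracAverage (μ : Measure X) (η : ℝ) (f : Fin m → X → ℝ) (B : Set X) : ℝ≥0∞ :=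
  μ B ^ η * ∏ i, ((μ B)⁻¹ * ∫⁻ y in B, ‖f i y‖ₑ ∂μ)

/-- The multilinear fractional maximal operator
`ℳ_η(f)(x) = sup_{B ∋ x} μ(B)^η ∏ᵢ ⟨|fᵢ|⟩_B`, over all balls `B` containing `x`. -/
def fracMaximal (d : QuasiMetric X) (μ : Measure X) (η : ℝ) (f : Fin m → X → ℝ) (x : X) :
    ℝ≥0∞ :=
  ⨆ (c : X) (r : ℝ) (_ : 0 < r) (_ : x ∈ d.ball c r), fracAverage μ η f (d.ball c r)

/-- The characteristic of the multiple weight `(ω₁, …, ω_m, ω)`: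
`sup_B μ(B)^{η - m} ‖ω χ_B‖_{q(·)} ∏ᵢ ‖ωᵢ⁻¹ χ_B‖_{pᵢ'(·)}`. -/
def weightChar (d : QuasiMetric X) (μ : Measure X) (η : ℝ) (p : Fin m → X → ℝ) (q : X → ℝ)
    (ω : Fin m → X → ℝ≥0∞) (ω₀ : X → ℝ≥0∞) : ℝ≥0∞ :=
  ⨆ (c : X) (r : ℝ) (_ : 0 < r),
    μ (d.ball c r) ^ (η - (m : ℝ)) * luxNorm (μ.restrict (d.ball c r)) q ω₀ *
      ∏ i, luxNorm (μ.restrict (d.ball c r)) (fun x => Real.conjExponent (p i x))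
        (fun x => (ω i x)⁻¹)

/-- Membership of `(ω₁, …, ω_m, ω)` in the class `A_{p(·), q(·)}(X)`. -/
def MemA (d : QuasiMetric X) (μ : Measure X) (η : ℝ) (p : Fin m → X → ℝ) (q : X → ℝ)
    (ω : Fin m → X → ℝ≥0∞) (ω₀ : X → ℝ≥0∞) : Prop :=
  weightChar d μ η p q ω ω₀ < ∞

/-- `ℳ_η` maps `∏ᵢ L^{pᵢ(·)}(X, ωᵢ)` to `WL^{q(·)}(X, ω)` with constant `C`. -/
def WeakBoundWith (d : QuasiMetric X) (μ : Measure X) (η : ℝ) (p : Fin m → X → ℝ) (q : X → ℝ)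
    (ω : Fin m → X → ℝ≥0∞) (ω₀ : X → ℝ≥0∞) (C : ℝ≥0) : Prop :=
  ∀ f : Fin m → X → ℝ, (∀ i, MemWLp μ (p i) (ω i) (f i)) →
    weakNorm μ q ω₀ (fracMaximal d μ η f) ≤ C * ∏ i, wNorm μ (p i) (ω i) (f i)

/-- `ℳ_η` is bounded from `∏ᵢ L^{pᵢ(·)}(X, ωᵢ)` to `WL^{q(·)}(X, ω)`. -/
def WeakBounded (d : QuasiMetric X) (μ : Measure X) (η : ℝ) (p : Fin m → X → ℝ) (q : X → ℝ)
    (ω : Fin m → X → ℝ≥0∞) (ω₀ : X → ℝ≥0∞) : Prop :=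
  ∃ C : ℝ≥0, WeakBoundWith d μ η p q ω ω₀ C

/-- The weak-type operator norm of `ℳ_η`: the infimum of the admissible constants
(`∞` if there is none). -/
def weakOpNorm (d : QuasiMetric X) (μ : Measure X) (η : ℝ) (p : Fin m → X → ℝ) (q : X → ℝ)
    (ω : Fin m → X → ℝ≥0∞) (ω₀ : X → ℝ≥0∞) : ℝ≥0∞ :=
  ⨅ (C : ℝ≥0) (_ : WeakBoundWith d μ η p q ω ω₀ C), (C : ℝ≥0∞)

end VarWeights

end

open VarWeights

open Filter
open scoped Topology

/-!
Necessity: on a fixed ball `B`, test the weak-type inequality on functions `fᵢ` that nearly attain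
by duality the norm of `ωᵢ⁻¹` in `L^{pᵢ'(·)}(B)`; everywhere on `B` the maximal function is at
least the average of these functions over `B`.

Sufficiency: the level set of the maximal function is a union of balls `B` on which
`‖t ω χ_B‖_{q(·)}` is controlled by `∏ᵢ ‖ωᵢ fᵢ χ_B‖_{pᵢ(·)}`. Balls near `x₀` relative to their
radius are covered by a dilate of one of them. The others are thinned out by a Vitali covering. On
each selected ball either the norms are so small that the modular of `t ω χ_B` is at most `∫_B g`
for one fixed integrable `g`, or log-Hölder continuity lets the exponents be frozen at a point of
`B`, where `1 / q ≤ ∑ᵢ 1 / pᵢ` turns the bound on norms into a bound on modulars. Both estimates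
sum over disjoint balls.
-/

namespace VarWeights

section Luxemburg

variable {X : Type*} [MeasurableSpace X] {μ ν : Measure X} {p : X → ℝ} {f : X → ℝ≥0∞} {r : ℝ≥0∞}

theorem luxNorm_mono_measure (h : μ ≤ ν) : luxNorm μ p f ≤ luxNorm ν p f :=
  sInf_le_sInf fun _ hr => ⟨hr.1, hr.2.1, (lintegral_mono' h le_rfl).trans hr.2.2⟩

theorem luxNorm_restrict_le (s : Set X) : luxNorm (μ.restrict s) p f ≤ luxNorm μ p f :=
  luxNorm_mono_measure Measure.restrict_le_self

theorem luxNorm_restrict_mono {s t : Set X} (h : s ⊆ t) :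
    luxNorm (μ.restrict s) p f ≤ luxNorm (μ.restrict t) p f :=
  luxNorm_mono_measure (Measure.restrict_mono h le_rfl)

theorem luxNorm_le_of_modular_le_one (h0 : r ≠ 0) (ht : r ≠ ∞)
    (h : ∫⁻ x, (f x / r) ^ p x ∂μ ≤ 1) : luxNorm μ p f ≤ r :=
  sInf_le ⟨h0.bot_lt, ht, h⟩

theorem modular_le_one_of_luxNorm_lt (hp : ∀ᵐ x ∂μ, 0 ≤ p x) (h : luxNorm μ p f < r) :
    ∫⁻ x, (f x / r) ^ p x ∂μ ≤ 1 := by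
  obtain ⟨s, hs, hsr⟩ := sInf_lt_iff.1 h
  refine (lintegral_mono_ae ?_).trans hs.2.2
  filter_upwards [hp] with x hx
  exact ENNReal.rpow_le_rpow (by gcongr) hx

theorem one_lt_modular_of_lt_luxNorm (h0 : r ≠ 0) (h : r < luxNorm μ p f) :
    1 < ∫⁻ x, (f x / r) ^ p x ∂μ := by
  by_contra! hc
  exact h.not_ge (luxNorm_le_of_modular_le_one h0 h.ne_top hc)

theorem luxNorm_zero_measure : luxNorm (0 : Measure X) p f = 0 :=
  le_antisymm (ENNReal.le_of_forall_pos_le_add fun ε hε _ => by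
    rw [zero_add]
    exact luxNorm_le_of_modular_le_one (by exact_mod_cast hε.ne') ENNReal.coe_ne_top (by simp))
    bot_le

theorem luxNorm_const_mul_le {c : ℝ≥0∞} (h0 : c ≠ 0) (ht : c ≠ ∞) :
    luxNorm μ p (fun x => c * f x) ≤ c * luxNorm μ p f := by
  rw [mul_comm, ← ENNReal.div_le_iff h0 ht]
  refine le_sInf fun r hr => ?_
  rw [ENNReal.div_le_iff h0 ht]
  refine luxNorm_le_of_modular_le_one (mul_ne_zero hr.1.ne' h0) (ENNReal.mul_ne_top hr.2.1 ht) ?_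
  simpa only [mul_comm r c, ENNReal.mul_div_mul_left _ _ h0 ht] using hr.2.2

theorem luxNorm_const_mul {c : ℝ≥0∞} (h0 : c ≠ 0) (ht : c ≠ ∞) :
    luxNorm μ p (fun x => c * f x) = c * luxNorm μ p f := by
  refine le_antisymm (luxNorm_const_mul_le h0 ht) ?_
  have h := luxNorm_const_mul_le (μ := μ) (p := p) (f := fun x => c * f x)
    (ENNReal.inv_ne_zero.2 ht) (ENNReal.inv_ne_top.2 h0)
  simp only [← mul_assoc, ENNReal.inv_mul_cancel h0 ht, one_mul] at h
  calc c * luxNorm μ p f ≤ c * (c⁻¹ * luxNorm μ p (fun x => c * f x)) := by gcongr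
    _ = _ := by rw [← mul_assoc, ENNReal.mul_inv_cancel h0 ht, one_mul]

theorem modular_div_luxNorm_le_one (hp : AEMeasurable p μ) (hp0 : ∀ᵐ x ∂μ, 0 ≤ p x)
    (hf : AEMeasurable f μ) (ht : luxNorm μ p f ≠ ∞) :
    ∫⁻ x, (f x / luxNorm μ p f) ^ p x ∂μ ≤ 1 := by
  obtain ⟨u, hu, hlt, hlim⟩ := exists_seq_strictAnti_tendsto' (lt_top_iff_ne_top.2 ht)
  refine le_of_tendsto' (lintegral_tendsto_of_tendsto_of_monotone
    (f := fun n x => (f x / u n) ^ p x) (fun n => (hf.div_const _).pow hp) ?_ ?_)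
    fun n => modular_le_one_of_luxNorm_lt hp0 (hlt n).1
  · filter_upwards [hp0] with x hx n k hnk
    exact ENNReal.rpow_le_rpow (ENNReal.div_le_div_left (hu.antitone hnk) _) hx
  · exact ae_of_all _ fun x => (ENNReal.continuous_rpow_const.tendsto _).comp
      (ENNReal.Tendsto.const_div hlim (Or.inl ht))

theorem ae_eq_zero_of_luxNorm_eq_zero (hp : AEMeasurable p μ) (hp0 : ∀ᵐ x ∂μ, 0 < p x)
    (hf : AEMeasurable f μ) (h : luxNorm μ p f = 0) : ∀ᵐ x ∂μ, f x = 0 := by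
  have hmod := modular_div_luxNorm_le_one hp (hp0.mono fun _ => le_of_lt) hf (by simp [h])
  filter_upwards [ae_lt_top' ((hf.div_const _).pow hp) (hmod.trans_lt ENNReal.one_lt_top).ne, hp0]
    with x hx hpx
  by_contra hfx
  simp [h, ENNReal.div_zero hfx, hpx] at hx

theorem luxNorm_ne_zero (hμ : μ ≠ 0) (hp : AEMeasurable p μ) (hp0 : ∀ᵐ x ∂μ, 0 < p x)
    (hf : AEMeasurable f μ) (hf0 : ∀ᵐ x ∂μ, 0 < f x) : luxNorm μ p f ≠ 0 := fun h =>
  hμ <| ae_eq_bot.1 <| eventually_false_iff_eq_bot.1 <| by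
    filter_upwards [ae_eq_zero_of_luxNorm_eq_zero hp hp0 hf h, hf0] with x hx hx0
    exact hx0.ne' hx

theorem modular_le_of_luxNorm_lt (hp0 : ∀ᵐ x ∂μ, 0 ≤ p x) (ht : r ≠ ∞) (h : luxNorm μ p f < r)
    {E : ℝ≥0∞} (hE : E ≠ ∞) (hrE : ∀ᵐ x ∂μ, r ^ p x ≤ E) : ∫⁻ x, f x ^ p x ∂μ ≤ E := by
  have h0 : r ≠ 0 := (bot_le.trans_lt h).ne'
  calc ∫⁻ x, f x ^ p x ∂μ ≤ ∫⁻ x, (f x / r) ^ p x * E ∂μ := by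
        refine lintegral_mono_ae ?_
        filter_upwards [hp0, hrE] with x hx hxE
        calc f x ^ p x = (f x / r) ^ p x * r ^ p x := by
              rw [← ENNReal.mul_rpow_of_nonneg _ _ hx, ENNReal.div_mul_cancel h0 ht]
          _ ≤ _ := by gcongr
    _ = (∫⁻ x, (f x / r) ^ p x ∂μ) * E := lintegral_mul_const' _ _ hE
    _ ≤ E := mul_le_of_le_one_left' (modular_le_one_of_luxNorm_lt hp0 h)

theorem le_modular_of_lt_luxNorm (hp0 : ∀ᵐ x ∂μ, 0 ≤ p x) (h0 : r ≠ 0) (h : r < luxNorm μ p f)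
    {E : ℝ≥0∞} (hE : E ≠ ∞) (hrE : ∀ᵐ x ∂μ, E ≤ r ^ p x) : E ≤ ∫⁻ x, f x ^ p x ∂μ := by
  calc E ≤ E * ∫⁻ x, (f x / r) ^ p x ∂μ :=
        le_mul_of_one_le_right' (one_lt_modular_of_lt_luxNorm h0 h).le
    _ = ∫⁻ x, E * (f x / r) ^ p x ∂μ := (lintegral_const_mul' _ _ hE).symm
    _ ≤ ∫⁻ x, f x ^ p x ∂μ := by
        refine lintegral_mono_ae ?_
        filter_upwards [hp0, hrE] with x hx hxE
        calc E * (f x / r) ^ p x ≤ r ^ p x * (f x / r) ^ p x := by gcongr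
          _ = f x ^ p x := by
            rw [← ENNReal.mul_rpow_of_nonneg _ _ hx, ENNReal.mul_div_cancel h0 h.ne_top]

theorem luxNorm_le_rpow_of_modular_le {a : ℝ} (ha : 0 < a) (hp : ∀ᵐ x ∂μ, a ≤ p x) {C : ℝ≥0∞}
    (hC1 : 1 ≤ C) (hCt : C ≠ ∞) (h : ∫⁻ x, f x ^ p x ∂μ ≤ C) : luxNorm μ p f ≤ C ^ (1 / a) := by
  have h1 : 1 ≤ C ^ (1 / a) := ENNReal.one_le_rpow hC1 (by positivity)
  refine luxNorm_le_of_modular_le_one (one_pos.trans_le h1).ne'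
    (ENNReal.rpow_ne_top_of_nonneg (by positivity) hCt) ?_
  calc ∫⁻ x, (f x / C ^ (1 / a)) ^ p x ∂μ ≤ ∫⁻ x, f x ^ p x * C⁻¹ ∂μ := by
        refine lintegral_mono_ae ?_
        filter_upwards [hp] with x hx
        rw [ENNReal.div_rpow_of_nonneg _ _ (ha.le.trans hx), div_eq_mul_inv]
        gcongr
        calc C = (C ^ (1 / a)) ^ a := by
              rw [← ENNReal.rpow_mul, one_div_mul_cancel ha.ne', ENNReal.rpow_one]
          _ ≤ (C ^ (1 / a)) ^ p x := ENNReal.rpow_le_rpow_of_exponent_le h1 hx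
    _ = (∫⁻ x, f x ^ p x ∂μ) * C⁻¹ :=
        lintegral_mul_const' _ _ (ENNReal.inv_ne_top.2 (one_pos.trans_le hC1).ne')
    _ ≤ C * C⁻¹ := by gcongr
    _ = 1 := ENNReal.mul_inv_cancel (one_pos.trans_le hC1).ne' hCt

end Luxemburg

section Holder

theorem prod_rpow_le_sup_rpow {ι : Type*} (s : Finset ι) (a : ι → ℝ≥0∞) (θ : ι → ℝ)
    (hθ : ∀ i ∈ s, 0 ≤ θ i) : ∏ i ∈ s, a i ^ θ i ≤ (s.sup a) ^ (∑ i ∈ s, θ i) := by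
  induction s using Finset.cons_induction with
  | empty => simp
  | cons i s hi ih =>
    have hθs : ∀ j ∈ s, 0 ≤ θ j := fun j hj => hθ j (Finset.mem_cons_of_mem hj)
    have hθi := hθ i (Finset.mem_cons_self i s)
    rw [Finset.prod_cons, Finset.sum_cons, Finset.sup_cons,
      ENNReal.rpow_add_of_nonneg _ _ hθi (Finset.sum_nonneg hθs)]
    gcongr
    · exact le_sup_left
    · exact (ih hθs).trans
        (ENNReal.rpow_le_rpow le_sup_right (Finset.sum_nonneg hθs))

variable {ι : Type*} [Fintype ι]

theorem prod_rpow_le_sup_rpow_mul_sum {s : ℝ} (hs : 0 ≤ s) {r : ι → ℝ} (hr : ∀ i, 0 < r i)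
    (c : ι → ℝ≥0∞) :
    ∏ i, c i ^ s ≤ (Finset.univ.sup fun i => c i ^ r i) ^ (s * ∑ i, 1 / r i) := by
  have h := prod_rpow_le_sup_rpow Finset.univ (fun i => c i ^ r i) (fun i => s / r i)
    fun i _ => div_nonneg hs (hr i).le
  simpa only [← ENNReal.rpow_mul, mul_div_cancel₀ _ (hr _).ne', Finset.mul_sum, mul_one_div] using h

theorem sup_univ_le_sum (a : ι → ℝ≥0∞) : Finset.univ.sup a ≤ ∑ i, a i :=
  Finset.sup_le fun _ hi => Finset.single_le_sum_of_canonicallyOrdered hi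

theorem prod_rpow_le_sum_rpow {s : ℝ} (hs : 0 < s) {r : ι → ℝ} (hr : ∀ i, 0 < r i)
    (hsum : ∑ i, 1 / r i = 1 / s) (c : ι → ℝ≥0∞) : ∏ i, c i ^ s ≤ ∑ i, c i ^ r i := by
  have h := prod_rpow_le_sup_rpow_mul_sum hs.le hr c
  rw [hsum, mul_one_div_cancel hs.ne', ENNReal.rpow_one] at h
  exact h.trans (sup_univ_le_sum _)

theorem prod_rpow_le_sum_rpow_of_le_one {s : ℝ} (hs : 0 < s) {r : ι → ℝ} (hr : ∀ i, 0 < r i)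
    (hsum : 1 / s ≤ ∑ i, 1 / r i) {c : ι → ℝ≥0∞} (hc : ∀ i, c i ≤ 1) :
    (∏ i, c i) ^ s ≤ ∑ i, c i ^ r i := by
  have h1 : 1 ≤ s * ∑ i, 1 / r i := by
    calc 1 = s * (1 / s) := (mul_one_div_cancel hs.ne').symm
      _ ≤ _ := by gcongr
  rw [← ENNReal.prod_rpow_of_nonneg hs.le]
  calc ∏ i, c i ^ s ≤ (Finset.univ.sup fun i => c i ^ r i) ^ (s * ∑ i, 1 / r i) :=
        prod_rpow_le_sup_rpow_mul_sum hs.le hr c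
    _ ≤ (Finset.univ.sup fun i => c i ^ r i) ^ (1 : ℝ) :=
        ENNReal.rpow_le_rpow_of_exponent_ge
          (Finset.sup_le fun i _ => ENNReal.rpow_le_one (hc i) (hr i).le) h1
    _ ≤ ∑ i, c i ^ r i := by
        rw [ENNReal.rpow_one]
        exact sup_univ_le_sum _

variable {X : Type*} [MeasurableSpace X] {μ : Measure X}

theorem lintegral_prod_rpow_le {s : ℝ} (hs : 0 < s) {r : ι → X → ℝ}
    (hrm : ∀ i, AEMeasurable (r i) μ) (hr : ∀ i, ∀ᵐ x ∂μ, 0 < r i x)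
    (hsum : ∀ᵐ x ∂μ, ∑ i, 1 / r i x = 1 / s) {h : ι → X → ℝ≥0∞} (hm : ∀ i, AEMeasurable (h i) μ) :
    ∫⁻ x, ∏ i, h i x ^ s ∂μ ≤ Fintype.card ι * ∏ i, luxNorm μ (r i) (h i) ^ s := by
  set L : ι → ℝ≥0∞ := fun i => luxNorm μ (r i) (h i)
  by_cases h0 : ∃ i, L i = 0
  · obtain ⟨i, hi⟩ := h0
    refine (lintegral_eq_zero_of_ae_eq_zero ?_).trans_le bot_le
    filter_upwards [ae_eq_zero_of_luxNorm_eq_zero (hrm i) (hr i) (hm i) hi] with x hx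
    exact Finset.prod_eq_zero (Finset.mem_univ i) (by simp [hx, hs])
  push Not at h0
  have hL0 : ∀ i, L i ^ s ≠ 0 := fun i => (ENNReal.rpow_pos_of_nonneg (h0 i).bot_lt hs.le).ne'
  by_cases ht : ∃ i, L i = ∞
  · obtain ⟨i, hi⟩ := ht
    have hcard : (Fintype.card ι : ℝ≥0∞) ≠ 0 := by
      exact_mod_cast (Fintype.card_pos_iff.2 ⟨i⟩).ne'
    have htop : ∏ i, L i ^ s = ∞ := by
      classical
      rw [← Finset.mul_prod_erase _ _ (Finset.mem_univ i), hi, ENNReal.top_rpow_of_pos hs,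
        ENNReal.top_mul (Finset.prod_ne_zero_iff.2 fun j _ => hL0 j)]
    rw [htop, ENNReal.mul_top hcard]
    exact le_top
  push Not at ht
  calc ∫⁻ x, ∏ i, h i x ^ s ∂μ = ∫⁻ x, (∏ i, (h i x / L i) ^ s) * ∏ i, L i ^ s ∂μ := by
        simp only [← Finset.prod_mul_distrib, ← ENNReal.mul_rpow_of_nonneg _ _ hs.le,
          ENNReal.div_mul_cancel (h0 _) (ht _)]
    _ = (∫⁻ x, ∏ i, (h i x / L i) ^ s ∂μ) * ∏ i, L i ^ s :=
        lintegral_mul_const' _ _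
          (ENNReal.prod_ne_top fun i _ => ENNReal.rpow_ne_top_of_nonneg hs.le (ht i))
    _ ≤ (∑ i, ∫⁻ x, (h i x / L i) ^ r i x ∂μ) * ∏ i, L i ^ s := by
        rw [← lintegral_finsetSum' _ fun i _ => ((hm i).div_const _).pow (hrm i)]
        gcongr ?_ * _
        refine lintegral_mono_ae ?_
        filter_upwards [hsum, ae_all_iff.2 hr] with x hx hrx
        exact prod_rpow_le_sum_rpow hs hrx hx _
    _ ≤ (∑ _i : ι, 1) * ∏ i, L i ^ s := by
        gcongr with i
        exact modular_div_luxNorm_le_one (hrm i) ((hr i).mono fun _ => le_of_lt) (hm i) (ht i)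
    _ = Fintype.card ι * ∏ i, L i ^ s := by simp

theorem lintegral_mul_le_luxNorm_mul_luxNorm {r r' : X → ℝ} (hrm : AEMeasurable r μ)
    (hrm' : AEMeasurable r' μ) (hr : ∀ᵐ x ∂μ, 0 < r x) (hr' : ∀ᵐ x ∂μ, 0 < r' x)
    (hsum : ∀ᵐ x ∂μ, 1 / r x + 1 / r' x = 1) {f g : X → ℝ≥0∞}
    (hf : AEMeasurable f μ) (hg : AEMeasurable g μ) :
    ∫⁻ x, f x * g x ∂μ ≤ 2 * (luxNorm μ r f * luxNorm μ r' g) := by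
  simpa using lintegral_prod_rpow_le one_pos (r := ![r, r']) (h := ![f, g])
    (by simp [Fin.forall_fin_two, hrm, hrm']) (by simp [Fin.forall_fin_two, hr, hr'])
    (by simpa using hsum) (by simp [Fin.forall_fin_two, hf, hg])

end Holder

section Geometry

variable {X : Type*} {d : QuasiMetric X} {A : ℝ} {x₀ : X}

namespace QuasiMetric

theorem self_eq_zero (d : QuasiMetric X) (x : X) : d x x = 0 :=
  (d.eq_zero_iff x x).2 rfl

theorem mem_ball_self (d : QuasiMetric X) (x : X) {r : ℝ} (hr : 0 < r) : x ∈ d.ball x r :=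
  (d.self_eq_zero x).trans_lt hr

theorem ball_subset_ball (d : QuasiMetric X) (x : X) {r s : ℝ} (h : r ≤ s) :
    d.ball x r ⊆ d.ball x s := fun _ hy => lt_of_lt_of_le hy h

/-- `A` is an admissible constant in the quasi-triangle inequality for `d`. -/
structure IsTriangleConst (d : QuasiMetric X) (A : ℝ) : Prop where
  one_le : 1 ≤ A
  le : ∀ x y z, d x y ≤ A * (d x z + d z y)

theorem exists_isTriangleConst (d : QuasiMetric X) : ∃ A, d.IsTriangleConst A :=
  d.quasi_triangle.imp fun _ h => ⟨h.1, h.2⟩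

namespace IsTriangleConst

variable (hA : d.IsTriangleConst A)

include hA

theorem ball_subset_ball_of_inter_nonempty {a b : X} {r s : ℝ} (hs : s ≤ 2 * r)
    (h : (d.ball a s ∩ d.ball b r).Nonempty) : d.ball a s ⊆ d.ball b (5 * A ^ 2 * r) := by
  obtain ⟨z, hza, hzb⟩ := h
  intro x hx
  have hA1 := hA.one_le
  have hax : d a x < s := hx
  have haz : d a z < s := hza
  have hbz : d b z < r := hzb
  have hr : 0 < r := (d.nonneg b z).trans_lt hbz
  have hzx : d z x < A * (4 * r) := by
    refine (hA.le z x a).trans_lt ?_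
    rw [d.symm z a]
    gcongr
    linarith
  have hbx : d b x < A * (r + A * (4 * r)) := (hA.le b x z).trans_lt (by gcongr)
  have hAr : 0 ≤ A * (A - 1) * r := by
    have := sub_nonneg.2 hA1
    positivity
  change d b x < 5 * A ^ 2 * r
  linarith

theorem ball_subset_ball_of_dist_lt {a b : X} {Λ r s : ℝ} (hΛ : 0 ≤ Λ) (hs : s ≤ 2 * r)
    (ha : d a x₀ < Λ * s) (hb : d b x₀ < Λ * r) :
    d.ball a s ⊆ d.ball b (A * (Λ + 2 * A * (Λ + 1)) * r) := by
  intro x hx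
  have hax : d a x < s := hx
  have hA0 : 0 < A := one_pos.trans_le hA.one_le
  have hx₀x : d x₀ x ≤ A * ((Λ + 1) * (2 * r)) := by
    refine (hA.le x₀ x a).trans ?_
    rw [d.symm x₀ a]
    gcongr
    calc d a x₀ + d a x ≤ (Λ + 1) * s := by linarith
      _ ≤ (Λ + 1) * (2 * r) := by gcongr
  calc d b x ≤ A * (d b x₀ + d x₀ x) := hA.le b x x₀
    _ < A * (Λ * r + A * ((Λ + 1) * (2 * r))) :=
        mul_lt_mul_of_pos_left (add_lt_add_of_lt_of_le hb hx₀x) hA0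
    _ = A * (Λ + 2 * A * (Λ + 1)) * r := by ring

theorem exists_biUnion_ball_subset_ball {Λ R : ℝ} (hΛ : 0 ≤ Λ) {S : Set (X × ℝ)}
    (hne : S.Nonempty) (hpos : ∀ b ∈ S, 0 < b.2) (hR : ∀ b ∈ S, b.2 ≤ R)
    (hS : ∀ b ∈ S, d b.1 x₀ < Λ * b.2) :
    ∃ b ∈ S, ⋃ b' ∈ S, d.ball b'.1 b'.2 ⊆
      d.ball b.1 (A * (Λ + 2 * A * (Λ + 1)) * b.2) := by
  have hbdd : BddAbove (Prod.snd '' S) := ⟨R, Set.forall_mem_image.2 hR⟩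
  have hsup : 0 < sSup (Prod.snd '' S) :=
    let ⟨b, hb⟩ := hne
    (hpos b hb).trans_le (le_csSup hbdd ⟨b, hb, rfl⟩)
  obtain ⟨_, ⟨b, hb, rfl⟩, hlt⟩ := exists_lt_of_lt_csSup (hne.image _) (half_lt_self hsup)
  refine ⟨b, hb, Set.iUnion₂_subset fun b' hb' => ?_⟩
  have hle := le_csSup hbdd ⟨b', hb', rfl⟩
  exact hA.ball_subset_ball_of_dist_lt hΛ (by linarith) (hS b' hb') (hS b hb)

theorem dist_le_of_mem_ball {c x : X} {s : ℝ} (hfar : 2 * A * s ≤ d c x₀) (hx : x ∈ d.ball c s) :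
    d c x₀ ≤ 2 * A * d x x₀ := by
  have hcx : d c x ≤ s := le_of_lt hx
  have hA0 : 0 < A := one_pos.trans_le hA.one_le
  have : d c x₀ ≤ A * (s + d x x₀) := (hA.le c x₀ x).trans (by gcongr)
  linarith

theorem dist_le_of_mem_ball_of_mem_ball {c x y : X} {s : ℝ} (hx : x ∈ d.ball c s)
    (hy : y ∈ d.ball c s) : d x y ≤ 2 * A * s := by
  have hcx : d x c ≤ s := by
    rw [d.symm x c]
    exact le_of_lt hx
  have hcy : d c y ≤ s := le_of_lt hy
  have hA0 : 0 < A := one_pos.trans_le hA.one_le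
  calc d x y ≤ A * (s + s) := (hA.le x y c).trans (by gcongr)
    _ = 2 * A * s := by ring

end IsTriangleConst

end QuasiMetric

/-- The size of the ball `B(c, r)` relative to the base point `x₀`: it is small when `r` is small
and when `c` is far from `x₀`, the two regimes in which log-Hölder continuity controls the
oscillation of an exponent. -/
noncomputable def ballScale (d : QuasiMetric X) (x₀ c : X) (r : ℝ) : ℝ :=
  min r 1 / (Real.exp 1 + d c x₀)

theorem one_add_le_exp_add (x y : X) : 1 + d x y ≤ Real.exp 1 + d x y := by
  linarith [Real.add_one_le_exp (1 : ℝ)]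

theorem one_le_exp_add (x y : X) : 1 ≤ Real.exp 1 + d x y := by
  linarith [one_add_le_exp_add (d := d) x y, d.nonneg x y]

theorem ballScale_pos (x₀ c : X) {r : ℝ} (hr : 0 < r) : 0 < ballScale d x₀ c r :=
  div_pos (lt_min hr one_pos) (one_pos.trans_le (one_le_exp_add _ _))

theorem ballScale_mul_le_one (x₀ c : X) (r : ℝ) :
    ballScale d x₀ c r * (Real.exp 1 + d c x₀) ≤ 1 := by
  rw [ballScale, div_mul_cancel₀ _ (one_pos.trans_le (one_le_exp_add _ _)).ne']
  exact min_le_right _ _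

theorem ballScale_le_one (x₀ c : X) {r : ℝ} (hr : 0 < r) : ballScale d x₀ c r ≤ 1 :=
  (le_mul_of_one_le_right (ballScale_pos x₀ c hr).le (one_le_exp_add c x₀)).trans
    (ballScale_mul_le_one x₀ c r)

theorem log_one_div_ballScale (x₀ c : X) {r : ℝ} (hr : 0 < r) :
    Real.log (1 / ballScale d x₀ c r) =
      Real.log (Real.exp 1 + d c x₀) + Real.log (1 / min r 1) := by
  have hmin : 0 < min r 1 := lt_min hr one_pos
  rw [ballScale, one_div_div, div_eq_mul_one_div,
    Real.log_mul (one_pos.trans_le (one_le_exp_add _ _)).ne' (one_div_pos.2 hmin).ne']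

theorem QuasiMetric.IsTriangleConst.ballScale_div_le_inv_one_add (hA : d.IsTriangleConst A)
    {c x : X} {r : ℝ} (hr : 0 < r) (hfar : r ≤ d c x₀) (hx : x ∈ d.ball c r) :
    ballScale d x₀ c r / (2 * A) ≤ (1 + d x₀ x)⁻¹ := by
  have hA1 := hA.one_le
  have hcx : d c x < r := hx
  have hx₀x := d.nonneg x₀ x
  have hδ := ballScale_pos (d := d) x₀ c hr
  have hdist : 1 + d x₀ x ≤ 2 * A * (Real.exp 1 + d c x₀) := by
    have hle : d x₀ x ≤ A * (2 * d c x₀) := by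
      refine (hA.le x₀ x c).trans ?_
      rw [d.symm x₀ c]
      gcongr
      linarith
    nlinarith [one_add_le_exp_add (d := d) c x₀]
  rw [le_inv_comm₀ (by positivity) (by positivity), inv_div, le_div_iff₀ hδ]
  calc (1 + d x₀ x) * ballScale d x₀ c r
      ≤ 2 * A * (Real.exp 1 + d c x₀) * ballScale d x₀ c r := by gcongr
    _ = 2 * A * (ballScale d x₀ c r * (Real.exp 1 + d c x₀)) := by ring
    _ ≤ 2 * A := mul_le_of_le_one_right (by positivity) (ballScale_mul_le_one x₀ c r)

end Geometry

section Doubling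

variable {X : Type*} [MeasurableSpace X] {d : QuasiMetric X} {μ : Measure X} {A : ℝ}

/-- `μ` is a doubling measure for the quasi-metric `d`, with measurable balls. -/
structure IsDoubling (d : QuasiMetric X) (μ : Measure X) : Prop where
  measurableSet_ball : ∀ (x : X) {r : ℝ}, 0 < r → MeasurableSet (d.ball x r)
  measure_ball_pos : ∀ (x : X) {r : ℝ}, 0 < r → 0 < μ (d.ball x r)
  measure_ball_lt_top : ∀ (x : X) {r : ℝ}, 0 < r → μ (d.ball x r) < ∞
  exists_measure_ball_two_mul_le : ∃ C : ℝ≥0, ∀ (x : X) (r : ℝ), 0 < r →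
    μ (d.ball x (2 * r)) ≤ C * μ (d.ball x r)

theorem IsHomogeneousType.isDoubling (hX : IsHomogeneousType d μ) : IsDoubling d μ := by
  obtain ⟨C, -, hC⟩ := hX.doubling
  refine ⟨fun x r hr => ?_, fun x r hr => ?_, fun x r hr => (hC x r hr).2.2,
    C, fun x r hr => (hC x r hr).2.1⟩
  · have h : MeasurableSet[d.sigmaAlgebra] (d.ball x r) :=
      MeasurableSpace.measurableSet_generateFrom (Or.inr ⟨x, r, hr, rfl⟩)
    rwa [← hX.measurableSpace_eq] at h
  · simpa only [mul_div_cancel₀ r two_ne_zero] using (hC x (r / 2) (half_pos hr)).1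

namespace IsDoubling

variable (hX : IsDoubling d μ)

include hX

theorem restrict_ball_ne_zero (c : X) {r : ℝ} (hr : 0 < r) : μ.restrict (d.ball c r) ≠ 0 := by
  rw [Ne, Measure.restrict_eq_zero]
  exact (hX.measure_ball_pos c hr).ne'

theorem exists_mem_ball_of_ae {P : X → Prop} (hP : ∀ᵐ x ∂μ, P x) (c : X) {r : ℝ} (hr : 0 < r) :
    ∃ y ∈ d.ball c r, P y := by
  by_contra! h
  exact (hX.measure_ball_pos c hr).ne' (measure_mono_null h (ae_iff.1 hP))

theorem exists_measure_ball_le_pow :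
    ∃ L : ℕ, ∀ (x : X) {r l : ℝ}, 0 < r → 1 ≤ l →
      μ (d.ball x (l * r)) ≤ ENNReal.ofReal ((2 * l) ^ L) * μ (d.ball x r) := by
  obtain ⟨C, hC⟩ := hX.exists_measure_ball_two_mul_le
  obtain ⟨L, hL⟩ := pow_unbounded_of_one_lt (C : ℝ) one_lt_two
  have hCL : (C : ℝ≥0∞) ≤ ENNReal.ofReal (2 ^ L) := by
    rw [← ENNReal.ofReal_coe_nnreal]
    exact ENNReal.ofReal_le_ofReal hL.le
  have hdyadic : ∀ (k : ℕ) (x : X) (r : ℝ), 0 < r →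
      μ (d.ball x (2 ^ k * r)) ≤ ENNReal.ofReal ((2 ^ k) ^ L) * μ (d.ball x r) := by
    intro k x r hr
    induction k with
    | zero => simp
    | succ k ih =>
      calc μ (d.ball x (2 ^ (k + 1) * r)) = μ (d.ball x (2 * (2 ^ k * r))) := by ring_nf
        _ ≤ C * μ (d.ball x (2 ^ k * r)) := hC x (2 ^ k * r) (by positivity)
        _ ≤ ENNReal.ofReal (2 ^ L) * (ENNReal.ofReal ((2 ^ k) ^ L) * μ (d.ball x r)) := by gcongr
        _ = ENNReal.ofReal ((2 ^ (k + 1)) ^ L) * μ (d.ball x r) := by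
          rw [← mul_assoc, ← ENNReal.ofReal_mul (by positivity), ← mul_pow, ← pow_succ']
  refine ⟨L, fun x r l hr hl => ?_⟩
  obtain ⟨k, hkl, hlk⟩ := exists_nat_pow_near hl one_lt_two
  calc μ (d.ball x (l * r)) ≤ μ (d.ball x (2 ^ (k + 1) * r)) :=
        measure_mono (d.ball_subset_ball x (by gcongr))
    _ ≤ ENNReal.ofReal ((2 ^ (k + 1)) ^ L) * μ (d.ball x r) := hdyadic (k + 1) x r hr
    _ ≤ ENNReal.ofReal ((2 * l) ^ L) * μ (d.ball x r) := by
        gcongr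
        rw [pow_succ']
        gcongr

theorem sigmaFinite (x₀ : X) : SigmaFinite μ :=
  ⟨⟨{ set := fun n => d.ball x₀ (n + 1)
      set_mem := fun _ => trivial
      finite := fun n => hX.measure_ball_lt_top x₀ (by positivity)
      spanning := Set.eq_univ_of_forall fun x => Set.mem_iUnion.2 <|
        (exists_nat_gt (d x₀ x)).imp fun n hn => hn.trans (lt_add_one (n : ℝ)) }⟩⟩

theorem exists_pow_mul_measure_ball_two_pow_le (x₀ : X) :
    ∃ (L : ℕ) (C : ℝ≥0), ∀ k : ℕ,
      ENNReal.ofReal ((1 / 2) ^ k) ^ L * μ (d.ball x₀ (2 ^ (k + 1))) ≤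
        C * ENNReal.ofReal (1 / 2) ^ k := by
  obtain ⟨L, hL⟩ := hX.exists_measure_ball_le_pow
  have hball := (hX.measure_ball_lt_top x₀ one_pos).ne
  have hC : ENNReal.ofReal (4 ^ L) * μ (d.ball x₀ 1) ≠ ∞ := by finiteness
  refine ⟨L + 1, (ENNReal.ofReal (4 ^ L) * μ (d.ball x₀ 1)).toNNReal, fun k => ?_⟩
  rw [ENNReal.coe_toNNReal hC]
  have hle := hL x₀ one_pos (one_le_pow₀ one_le_two (n := k + 1) (M₀ := ℝ))
  rw [mul_one] at hle
  have hpow : ((1 / 2 : ℝ) ^ k) ^ (L + 1) * (2 * 2 ^ (k + 1)) ^ L = 4 ^ L * (1 / 2) ^ k := by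
    rw [pow_succ ((1 / 2 : ℝ) ^ k), mul_right_comm, ← mul_pow]
    congr 2
    rw [one_div_pow]
    field_simp
    ring
  calc ENNReal.ofReal ((1 / 2) ^ k) ^ (L + 1) * μ (d.ball x₀ (2 ^ (k + 1)))
      ≤ ENNReal.ofReal ((1 / 2) ^ k) ^ (L + 1) *
          (ENNReal.ofReal ((2 * 2 ^ (k + 1)) ^ L) * μ (d.ball x₀ 1)) := by gcongr
    _ = ENNReal.ofReal (4 ^ L * (1 / 2) ^ k) * μ (d.ball x₀ 1) := by
        rw [← mul_assoc, ← ENNReal.ofReal_pow (by positivity), ← ENNReal.ofReal_mul (by positivity),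
          hpow]
    _ = _ := by
        rw [ENNReal.ofReal_mul (by positivity), ENNReal.ofReal_pow (by positivity) k]
        ring

theorem exists_lintegral_decay_lt_top (x₀ : X) :
    ∃ K : ℕ, ∫⁻ x, ENNReal.ofReal ((1 + d x₀ x)⁻¹ ^ K) ∂μ < ∞ := by
  obtain ⟨L, C, hC⟩ := hX.exists_pow_mul_measure_ball_two_pow_le x₀
  have hmeas : ∀ k : ℕ, MeasurableSet (d.ball x₀ (2 ^ (k + 1))) := fun k =>
    hX.measurableSet_ball x₀ (by positivity)
  let g : ℕ → X → ℝ≥0∞ := fun k =>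
    (d.ball x₀ (2 ^ (k + 1))).indicator fun _ => ENNReal.ofReal ((1 / 2) ^ k) ^ L
  have hle : ∀ x, ENNReal.ofReal ((1 + d x₀ x)⁻¹ ^ L) ≤ ∑' k, g k x := by
    intro x
    obtain ⟨k, hk, hk'⟩ := exists_nat_pow_near (by linarith [d.nonneg x₀ x] : 1 ≤ 1 + d x₀ x)
      one_lt_two
    refine le_trans ?_ (ENNReal.le_tsum k)
    have hmem : x ∈ d.ball x₀ (2 ^ (k + 1)) := (lt_one_add _).trans hk'
    rw [ENNReal.ofReal_pow (by have := d.nonneg x₀ x; positivity)]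
    simp only [g, Set.indicator_of_mem hmem, one_div, inv_pow]
    gcongr
  refine ⟨L, (lintegral_mono hle).trans_lt ?_⟩
  rw [lintegral_tsum fun k => (measurable_const.indicator (hmeas k)).aemeasurable]
  have hg : ∀ k, ∫⁻ x, g k x ∂μ ≤ C * ENNReal.ofReal (1 / 2) ^ k := fun k =>
    (lintegral_indicator_const (hmeas k) _).trans_le (hC k)
  refine (ENNReal.tsum_le_tsum hg).trans_lt ?_
  rw [ENNReal.tsum_mul_left, ENNReal.tsum_geometric]
  refine ENNReal.mul_lt_top ENNReal.coe_lt_top (ENNReal.inv_lt_top.2 ?_)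
  exact tsub_pos_of_lt (ENNReal.ofReal_lt_one.2 one_half_lt_one)

theorem exists_ballScale_pow_le_measure_ball (hA : d.IsTriangleConst A) (x₀ : X) :
    ∃ (L : ℕ) (C : ℝ≥0), ∀ (c : X) {r : ℝ}, 0 < r →
      ENNReal.ofReal (ballScale d x₀ c r ^ L) ≤ C * μ (d.ball c r) := by
  obtain ⟨L, hL⟩ := hX.exists_measure_ball_le_pow
  set b := μ (d.ball x₀ 1)
  have hb0 : b ≠ 0 := (hX.measure_ball_pos x₀ one_pos).ne'
  have hbt : b ≠ ∞ := (hX.measure_ball_lt_top x₀ one_pos).ne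
  have hCt : ENNReal.ofReal ((2 * A) ^ L) * b⁻¹ ≠ ∞ := by finiteness
  refine ⟨L, (ENNReal.ofReal ((2 * A) ^ L) * b⁻¹).toNNReal, fun c r hr => ?_⟩
  rw [ENNReal.coe_toNNReal hCt]
  have hA1 := hA.one_le
  set δ := ballScale d x₀ c r with hδ
  have hδ0 : 0 < δ := ballScale_pos x₀ c hr
  have hmin : 0 < min r 1 := lt_min hr one_pos
  have hE := one_le_exp_add (d := d) c x₀
  have hsub : d.ball x₀ 1 ⊆ d.ball c (A / δ * min r 1) := by
    intro z hz
    have hz1 : d x₀ z < 1 := hz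
    calc d c z ≤ A * (d c x₀ + d x₀ z) := hA.le c z x₀
      _ < A * (Real.exp 1 + d c x₀) :=
          mul_lt_mul_of_pos_left (by linarith [one_add_le_exp_add (d := d) c x₀])
            (one_pos.trans_le hA1)
      _ = A / δ * min r 1 := by
          rw [hδ, ballScale]
          field_simp
  have hAδ : 1 ≤ A / δ := (one_le_div hδ0).2 ((ballScale_le_one x₀ c hr).trans hA1)
  have hball : b ≤ ENNReal.ofReal ((2 * (A / δ)) ^ L) * μ (d.ball c r) := by
    refine (measure_mono hsub).trans ((hL c hmin hAδ).trans ?_)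
    gcongr
    exact d.ball_subset_ball c (min_le_left _ _)
  calc ENNReal.ofReal (δ ^ L) = ENNReal.ofReal (δ ^ L) * (b * b⁻¹) := by
        rw [ENNReal.mul_inv_cancel hb0 hbt, mul_one]
    _ ≤ ENNReal.ofReal (δ ^ L) *
          (ENNReal.ofReal ((2 * (A / δ)) ^ L) * μ (d.ball c r) * b⁻¹) := by gcongr
    _ = ENNReal.ofReal (δ ^ L * (2 * (A / δ)) ^ L) * b⁻¹ * μ (d.ball c r) := by
        rw [ENNReal.ofReal_mul (by positivity)]
        ring
    _ = ENNReal.ofReal ((2 * A) ^ L) * b⁻¹ * μ (d.ball c r) := by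
        rw [← mul_pow]
        congr 4
        field_simp

theorem exists_ballScale_pow_le_setLIntegral (hA : d.IsTriangleConst A) (x₀ : X) :
    ∃ (M : ℕ) (g : X → ℝ≥0∞), ∫⁻ x, g x ∂μ < ∞ ∧ ∀ (c : X) {r : ℝ}, 0 < r → r ≤ d c x₀ →
      ENNReal.ofReal (ballScale d x₀ c r ^ M) ≤ ∫⁻ x in d.ball c r, g x ∂μ := by
  obtain ⟨L, C, hC⟩ := hX.exists_ballScale_pow_le_measure_ball hA x₀
  obtain ⟨K, hK⟩ := hX.exists_lintegral_decay_lt_top x₀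
  have hA1 := hA.one_le
  set a : ℝ≥0∞ := C * ENNReal.ofReal ((2 * A) ^ K)
  have hat : a ≠ ∞ := by finiteness
  refine ⟨K + L, fun x => a * ENNReal.ofReal ((1 + d x₀ x)⁻¹ ^ K), ?_, fun c r hr hfar => ?_⟩
  · rw [lintegral_const_mul' _ _ hat]
    exact ENNReal.mul_lt_top hat.lt_top hK
  set δ := ballScale d x₀ c r
  have hδ0 : 0 < δ := ballScale_pos x₀ c hr
  rw [lintegral_const_mul' _ _ hat]
  calc ENNReal.ofReal (δ ^ (K + L))
      = ENNReal.ofReal ((2 * A) ^ K) * ENNReal.ofReal ((δ / (2 * A)) ^ K) *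
          ENNReal.ofReal (δ ^ L) := by
        rw [← ENNReal.ofReal_mul (by positivity), ← ENNReal.ofReal_mul (by positivity), ← mul_pow,
          mul_div_cancel₀ _ (by positivity), pow_add]
    _ ≤ ENNReal.ofReal ((2 * A) ^ K) * ENNReal.ofReal ((δ / (2 * A)) ^ K) *
          (C * μ (d.ball c r)) := by
        gcongr
        exact hC c hr
    _ = a * ∫⁻ _ in d.ball c r, ENNReal.ofReal ((δ / (2 * A)) ^ K) ∂μ := by
        rw [setLIntegral_const]
        ring
    _ ≤ _ := by
        gcongr a * ?_
        refine setLIntegral_mono' (hX.measurableSet_ball c hr) fun x hx => ?_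
        gcongr
        exact hA.ballScale_div_le_inv_one_add hr hfar hx

theorem exists_countable_disjoint_subfamily (hA : d.IsTriangleConst A) (x₀ : X) {S : Set (X × ℝ)}
    {R : ℝ} (hpos : ∀ b ∈ S, 0 < b.2) (hR : ∀ b ∈ S, b.2 ≤ R) :
    ∃ u ⊆ S, u.Countable ∧ u.PairwiseDisjoint (fun b => d.ball b.1 b.2) ∧
      ⋃ b ∈ S, d.ball b.1 b.2 ⊆ ⋃ b ∈ u, d.ball b.1 (5 * A ^ 2 * b.2) := by
  obtain ⟨u, huS, hdisj, hu⟩ := Vitali.exists_disjoint_subfamily_covering_enlargement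
    (fun b : X × ℝ => d.ball b.1 b.2) S Prod.snd 2 one_lt_two
    (fun b hb => (hpos b hb).le) R hR fun b hb => ⟨b.1, d.mem_ball_self _ (hpos b hb)⟩
  refine ⟨u, huS, ?_, hdisj, Set.iUnion₂_subset fun a ha => ?_⟩
  · have := hX.sigmaFinite x₀
    have hcount := Measure.countable_meas_pos_of_disjoint_iUnion (μ := μ)
      (As := fun b : u => d.ball b.1.1 b.1.2)
      (fun b => hX.measurableSet_ball _ (hpos b (huS b.2)))
      fun x y hxy => hdisj x.2 y.2 (Subtype.coe_injective.ne hxy)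
    rw [Set.eq_univ_of_forall (s := {b : u | 0 < μ (d.ball b.1.1 b.1.2)})
      fun b => hX.measure_ball_pos _ (hpos b (huS b.2))] at hcount
    exact Set.countable_coe_iff.1 (Set.countable_univ_iff.1 hcount)
  · obtain ⟨b, hb, hinter, hab⟩ := hu a ha
    exact Set.subset_biUnion_of_mem (u := fun b : X × ℝ => d.ball b.1 (5 * A ^ 2 * b.2)) hb
      |>.trans' (hA.ball_subset_ball_of_inter_nonempty hab hinter)

theorem tsum_setLIntegral_ball_le {u : Set (X × ℝ)} (hu : u.Countable) (hpos : ∀ b ∈ u, 0 < b.2)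
    (hdisj : u.PairwiseDisjoint fun b => d.ball b.1 b.2) (f : X → ℝ≥0∞) :
    ∑' b : u, ∫⁻ x in d.ball b.1.1 b.1.2, f x ∂μ ≤ ∫⁻ x, f x ∂μ := by
  rw [← lintegral_biUnion (s := fun b : X × ℝ => d.ball b.1 b.2) hu
    (fun b hb => hX.measurableSet_ball _ (hpos b hb)) hdisj]
  exact setLIntegral_le_lintegral _ _

end IsDoubling

end Doubling

section LogHolder

variable {X : Type*} {d : QuasiMetric X} {x₀ : X} {p : X → ℝ} {A : ℝ}

theorem one_le_log_exp_add {t : ℝ} (ht : 0 ≤ t) : 1 ≤ Real.log (Real.exp 1 + t) := by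
  rw [Real.le_log_iff_exp_le (by positivity)]
  linarith

theorem log_exp_add_le {K s t : ℝ} (hK : 1 ≤ K) (hs : 0 ≤ s) (ht : 0 ≤ t) (h : s ≤ K * t) :
    Real.log (Real.exp 1 + s) ≤ (1 + Real.log K) * Real.log (Real.exp 1 + t) := by
  have hlog := one_le_log_exp_add ht
  have hlogK := Real.log_nonneg hK
  calc Real.log (Real.exp 1 + s) ≤ Real.log (K * (Real.exp 1 + t)) := by
        gcongr
        nlinarith [Real.exp_pos 1]
    _ = Real.log K + Real.log (Real.exp 1 + t) := Real.log_mul (by positivity) (by positivity)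
    _ ≤ (1 + Real.log K) * Real.log (Real.exp 1 + t) := by nlinarith

theorem LHInfty.exists_abs_sub_le (hp : LHInfty d x₀ p) :
    ∃ K : ℝ, ∀ x y, |p x - p y| ≤ K := by
  obtain ⟨pInf, C, hC⟩ := hp
  have hC0 : 0 ≤ C := by simpa [d.self_eq_zero] using (abs_nonneg _).trans (hC x₀)
  have hbound : ∀ z, |p z - pInf| ≤ C := fun z =>
    (hC z).trans (div_le_self hC0 (one_le_log_exp_add (d.nonneg _ _)))
  refine ⟨C + C, fun x y => (abs_sub_le (p x) pInf (p y)).trans ?_⟩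
  rw [abs_sub_comm pInf]
  exact add_le_add (hbound x) (hbound y)

theorem LHInfty.exists_osc_mul_log_le (hp : LHInfty d x₀ p) (hA : d.IsTriangleConst A) :
    ∃ K : ℝ, ∀ (c : X) (s : ℝ), 2 * A * s ≤ d c x₀ → ∀ x ∈ d.ball c s, ∀ y ∈ d.ball c s,
      |p x - p y| * Real.log (Real.exp 1 + d c x₀) ≤ K := by
  obtain ⟨pInf, C, hC⟩ := hp
  have hA1 : 1 ≤ 2 * A := by linarith [hA.one_le]
  have hlogA := Real.log_nonneg hA1
  refine ⟨2 * (C * (1 + Real.log (2 * A))), fun c s hfar x hx y hy => ?_⟩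
  have key : ∀ z ∈ d.ball c s,
      |p z - pInf| * Real.log (Real.exp 1 + d c x₀) ≤ C * (1 + Real.log (2 * A)) := by
    intro z hz
    have hz0 := d.nonneg z x₀
    have hCz := hC z
    rw [le_div_iff₀ (one_pos.trans_le (one_le_log_exp_add hz0))] at hCz
    calc |p z - pInf| * Real.log (Real.exp 1 + d c x₀)
        ≤ |p z - pInf| * ((1 + Real.log (2 * A)) * Real.log (Real.exp 1 + d z x₀)) := by
          gcongr
          exact log_exp_add_le hA1 (d.nonneg c x₀) hz0 (hA.dist_le_of_mem_ball hfar hz)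
      _ = |p z - pInf| * Real.log (Real.exp 1 + d z x₀) * (1 + Real.log (2 * A)) := by ring
      _ ≤ C * (1 + Real.log (2 * A)) := by gcongr
  have hlog := one_le_log_exp_add (d.nonneg c x₀)
  calc |p x - p y| * Real.log (Real.exp 1 + d c x₀)
      ≤ (|p x - pInf| + |pInf - p y|) * Real.log (Real.exp 1 + d c x₀) := by
        gcongr
        exact abs_sub_le _ _ _
    _ ≤ 2 * (C * (1 + Real.log (2 * A))) := by
        rw [abs_sub_comm pInf]
        linarith [key x hx, key y hy]

theorem abs_sub_mul_log_one_div_le {C D r : ℝ} {x y : X} (hD : 1 ≤ D) (hr : 0 < r)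
    (hxy : x ≠ y) (hdxy : d x y ≤ D * r)
    (hC : |p x - p y| ≤ C / Real.log (Real.exp 1 + 1 / d x y)) :
    |p x - p y| * Real.log (1 / r) ≤ C * (1 + Real.log D) := by
  have hlogD := Real.log_nonneg hD
  have hd0 : 0 < d x y := (d.nonneg x y).lt_of_ne fun h => hxy ((d.eq_zero_iff x y).1 h.symm)
  rw [le_div_iff₀ (one_pos.trans_le (one_le_log_exp_add (one_div_pos.2 hd0).le))] at hC
  have hlog : Real.log (1 / r) ≤ (1 + Real.log D) * Real.log (Real.exp 1 + 1 / d x y) := by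
    refine (Real.log_le_log (by positivity) (le_add_of_nonneg_left (Real.exp_pos 1).le)).trans
      (log_exp_add_le hD (one_div_pos.2 hr).le (one_div_pos.2 hd0).le ?_)
    rw [mul_one_div, div_le_div_iff₀ hr hd0]
    linarith
  calc |p x - p y| * Real.log (1 / r)
      ≤ |p x - p y| * ((1 + Real.log D) * Real.log (Real.exp 1 + 1 / d x y)) := by gcongr
    _ = |p x - p y| * Real.log (Real.exp 1 + 1 / d x y) * (1 + Real.log D) := by ring
    _ ≤ C * (1 + Real.log D) := by gcongr

theorem LH.exists_osc_mul_log_one_div_le (hp : LH d x₀ p) {D : ℝ} (hD : 1 ≤ D) :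
    ∃ K : ℝ, 0 ≤ K ∧ ∀ (x y : X) {r : ℝ}, 0 < r → r ≤ 1 → d x y ≤ D * r →
      |p x - p y| * Real.log (1 / r) ≤ K := by
  obtain ⟨⟨C, hC⟩, hinf⟩ := hp
  obtain ⟨K, hK⟩ := hinf.exists_abs_sub_le
  have hC0 : 0 ≤ C := by
    simpa [d.self_eq_zero] using hC x₀ x₀ (by rw [d.self_eq_zero]; norm_num)
  have hK0 : 0 ≤ K := (abs_nonneg _).trans (hK x₀ x₀)
  have hlogD := Real.log_nonneg hD
  have hlog2D := Real.log_nonneg (by linarith : 1 ≤ 2 * D)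
  refine ⟨C * (1 + Real.log D) + K * Real.log (2 * D), by positivity, fun x y r hr hr1 hdxy => ?_⟩
  rcases eq_or_ne x y with rfl | hxy
  · simp only [sub_self, abs_zero, zero_mul]
    positivity
  rcases lt_or_ge (d x y) (1 / 2) with hnear | hfar
  · exact (abs_sub_mul_log_one_div_le hD hr hxy hdxy (hC x y hnear)).trans
      (le_add_of_nonneg_right (by positivity))
  · have hlogr : 0 ≤ Real.log (1 / r) := Real.log_nonneg ((one_le_div hr).2 hr1)
    have hlog : Real.log (1 / r) ≤ Real.log (2 * D) := by
      refine Real.log_le_log (by positivity) ?_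
      rw [div_le_iff₀ hr]
      linarith
    calc |p x - p y| * Real.log (1 / r) ≤ K * Real.log (2 * D) := by
          gcongr
          exact hK x y
      _ ≤ _ := le_add_of_nonneg_left (by positivity)

theorem LH.exists_osc_mul_log_ballScale_le (hp : LH d x₀ p) (hA : d.IsTriangleConst A) {κ : ℝ}
    (hκ : 1 ≤ κ) :
    ∃ K : ℝ, ∀ (c : X) {r : ℝ}, 0 < r → 2 * A * (κ * r) ≤ d c x₀ →
      ∀ x ∈ d.ball c (κ * r), ∀ y ∈ d.ball c (κ * r),
        |p x - p y| * Real.log (1 / ballScale d x₀ c r) ≤ K := by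
  obtain ⟨K₁, hK₁⟩ := hp.2.exists_osc_mul_log_le hA
  obtain ⟨K₂, hK₂0, hK₂⟩ := hp.exists_osc_mul_log_one_div_le
    (by nlinarith [hA.one_le] : 1 ≤ 2 * A * κ)
  refine ⟨K₁ + K₂, fun c r hr hfar x hx y hy => ?_⟩
  rw [log_one_div_ballScale x₀ c hr, mul_add]
  refine add_le_add (hK₁ c _ hfar x hx y hy) ?_
  rcases le_total 1 r with hr1 | hr1
  · simpa [min_eq_right hr1] using hK₂0
  · rw [min_eq_left hr1]
    refine hK₂ x y hr hr1 ((hA.dist_le_of_mem_ball_of_mem_ball hx hy).trans_eq ?_)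
    ring

theorem exists_forall_osc_mul_log_ballScale_le {ι : Type*} [Finite ι] {pvec : ι → X → ℝ}
    (hLH : ∀ i, LH d x₀ (pvec i)) (hA : d.IsTriangleConst A) {κ : ℝ} (hκ : 1 ≤ κ) :
    ∃ K : ℝ, ∀ i, ∀ (c : X) {r : ℝ}, 0 < r → 2 * A * (κ * r) ≤ d c x₀ →
      ∀ x ∈ d.ball c (κ * r), ∀ y ∈ d.ball c (κ * r),
        |pvec i x - pvec i y| * Real.log (1 / ballScale d x₀ c r) ≤ K := by
  choose K hK using fun i => (hLH i).exists_osc_mul_log_ballScale_le hA hκ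
  obtain ⟨B, hB⟩ := Finite.exists_le K
  exact ⟨B, fun i c r hr hfar x hx y hy => (hK i c hr hfar x hx y hy).trans (hB i)⟩

end LogHolder

section Exponents

variable {X : Type*} [MeasurableSpace X] {μ : Measure X} {p q : X → ℝ}

theorem exists_ae_lt_of_lt_essInf {a : ℝ} (ha : 0 ≤ a)
    (h : ENNReal.ofReal a < essInf (fun x => ENNReal.ofReal (p x)) μ) :
    ∃ b, a < b ∧ ∀ᵐ x ∂μ, b < p x := by
  obtain ⟨c, hac, hc⟩ := exists_between h
  refine ⟨c.toReal, (ENNReal.ofReal_lt_iff_lt_toReal ha hc.ne_top).1 hac, ?_⟩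
  filter_upwards [ae_lt_of_lt_essInf hc] with x hx
  exact (ENNReal.lt_ofReal_iff_toReal_lt hc.ne_top).1 hx

theorem exists_ae_lt_of_essSup_lt_top (hp : ∀ x, 0 ≤ p x)
    (h : essSup (fun x => ENNReal.ofReal (p x)) μ < ∞) : ∃ b, ∀ᵐ x ∂μ, p x < b := by
  obtain ⟨c, hc, hct⟩ := exists_between h
  refine ⟨c.toReal, ?_⟩
  filter_upwards [ae_lt_of_essSup_lt hc] with x hx
  exact (ENNReal.ofReal_lt_iff_lt_toReal (hp x) hct.ne).1 hx

namespace IsExpP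

theorem nonneg (hp : IsExpP μ p) (x : X) : 0 ≤ p x := zero_le_one.trans (hp.one_le x)

theorem exists_ae_gt (hp : IsExpP μ p) : ∃ a, 1 < a ∧ ∀ᵐ x ∂μ, a < p x :=
  exists_ae_lt_of_lt_essInf zero_le_one (by simpa using hp.one_lt_essInf)

theorem exists_ae_lt (hp : IsExpP μ p) : ∃ b, ∀ᵐ x ∂μ, p x < b :=
  exists_ae_lt_of_essSup_lt_top hp.nonneg hp.essSup_lt_top

theorem ae_holderConjugate (hp : IsExpP μ p) :
    ∀ᵐ x ∂μ, (p x).HolderConjugate (p x).conjExponent := by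
  obtain ⟨a, ha, h⟩ := hp.exists_ae_gt
  exact h.mono fun x hx => Real.HolderConjugate.conjExponent (ha.trans hx)

theorem ae_conjExponent_pos (hp : IsExpP μ p) : ∀ᵐ x ∂μ, 0 < (p x).conjExponent :=
  hp.ae_holderConjugate.mono fun _ hx => hx.symm.pos

theorem measurable_conjExponent (hp : IsExpP μ p) : Measurable fun x => (p x).conjExponent :=
  hp.measurable.div (hp.measurable.sub_const 1)

theorem exists_ae_conjExponent_le (hp : IsExpP μ p) :
    ∃ b, ∀ᵐ x ∂μ, (p x).conjExponent ≤ b := by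
  obtain ⟨a, ha, h⟩ := hp.exists_ae_gt
  refine ⟨a / (a - 1), ?_⟩
  filter_upwards [h] with x hx
  rw [Real.conjExponent, div_le_div_iff₀ (by linarith) (by linarith)]
  linarith

end IsExpP

namespace IsExpP0

theorem exists_ae_gt (hq : IsExpP0 μ q) : ∃ a, 0 < a ∧ ∀ᵐ x ∂μ, a < q x :=
  exists_ae_lt_of_lt_essInf le_rfl (by simpa using hq.essInf_pos)

theorem exists_ae_lt (hq : IsExpP0 μ q) : ∃ b, ∀ᵐ x ∂μ, q x < b :=
  exists_ae_lt_of_essSup_lt_top hq.nonneg hq.essSup_lt_top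

theorem ae_pos (hq : IsExpP0 μ q) : ∀ᵐ x ∂μ, 0 < q x := by
  obtain ⟨a, ha, h⟩ := hq.exists_ae_gt
  exact h.mono fun x hx => ha.trans hx

end IsExpP0

variable {ι : Type*} [Fintype ι]

theorem abs_sub_mul_le_of_one_div {σ τ : ι → ℝ} {s t η b K L : ℝ} (hσ : ∀ i, 1 ≤ σ i)
    (hτ : ∀ i, 1 ≤ τ i) (hs0 : 0 < s) (hsb : s ≤ b) (ht0 : 0 < t) (htb : t ≤ b)
    (hs : 1 / s = ∑ i, 1 / σ i - η) (ht : 1 / t = ∑ i, 1 / τ i - η) (hL : 0 ≤ L)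
    (hK : ∀ i, |σ i - τ i| * L ≤ K) : |s - t| * L ≤ b ^ 2 * (Fintype.card ι * K) := by
  have hinv : |1 / s - 1 / t| ≤ ∑ i, |σ i - τ i| := by
    rw [hs, ht, sub_sub_sub_cancel_right, ← Finset.sum_sub_distrib]
    refine (Finset.abs_sum_le_sum_abs _ _).trans (Finset.sum_le_sum fun i _ => ?_)
    have hσi := hσ i
    have hτi := hτ i
    rw [div_sub_div _ _ (by positivity) (by positivity), one_mul, mul_one, abs_div, abs_sub_comm]
    refine div_le_self (abs_nonneg _) ?_
    rw [abs_of_pos (by positivity)]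
    exact one_le_mul_of_one_le_of_one_le hσi hτi
  have hsub : |s - t| = s * t * |1 / s - 1 / t| := by
    rw [← abs_of_pos (mul_pos hs0 ht0), ← abs_mul, abs_sub_comm]
    congr 1
    field_simp
  calc |s - t| * L ≤ b * b * (∑ i, |σ i - τ i|) * L := by
        have hb : 0 ≤ b := hs0.le.trans hsb
        rw [hsub]
        gcongr
    _ = b ^ 2 * ∑ i, |σ i - τ i| * L := by
        rw [← Finset.sum_mul]
        ring
    _ ≤ b ^ 2 * ∑ _i : ι, K := by
        gcongr with i
        exact hK i
    _ = b ^ 2 * (Fintype.card ι * K) := by simp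

theorem rpow_le_exp_mul_rpow {v : ℝ≥0∞} {δ N K a b : ℝ} (hδ : 0 < δ) (hN : 0 ≤ N)
    (hv : ENNReal.ofReal (δ ^ N) ≤ v) (hv1 : v ≤ 1) (hab : |a - b| * Real.log (1 / δ) ≤ K) :
    v ^ a ≤ ENNReal.ofReal (Real.exp (N * K)) * v ^ b := by
  have hδN : 0 < δ ^ N := Real.rpow_pos_of_pos hδ N
  lift v to ℝ≥0 using ne_top_of_le_ne_top ENNReal.one_ne_top hv1
  have hδv : δ ^ N ≤ v := by
    rw [← ENNReal.ofReal_coe_nnreal] at hv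
    exact (ENNReal.ofReal_le_ofReal_iff v.2).1 hv
  have hv0 : (0 : ℝ) < v := hδN.trans_le hδv
  have hlog0 : Real.log v ≤ 0 := Real.log_nonpos hv0.le (by exact_mod_cast hv1)
  have hlog : -Real.log v ≤ N * Real.log (1 / δ) := by
    have h := Real.log_le_log hδN hδv
    rw [Real.log_rpow hδ] at h
    rw [one_div, Real.log_inv]
    linarith
  have hexp : Real.log v * (a - b) ≤ N * K := by
    calc Real.log v * (a - b) ≤ |Real.log v * (a - b)| := le_abs_self _
      _ = -Real.log v * |a - b| := by rw [abs_mul, abs_of_nonpos hlog0]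
      _ ≤ N * Real.log (1 / δ) * |a - b| := by gcongr
      _ = N * (|a - b| * Real.log (1 / δ)) := by ring
      _ ≤ N * K := by gcongr
  rw [← ENNReal.ofReal_coe_nnreal, ENNReal.ofReal_rpow_of_pos hv0, ENNReal.ofReal_rpow_of_pos hv0,
    ← ENNReal.ofReal_mul (Real.exp_pos _).le]
  refine ENNReal.ofReal_le_ofReal ?_
  rw [Real.rpow_def_of_pos hv0, Real.rpow_def_of_pos hv0, ← Real.exp_add]
  gcongr
  linarith

theorem modular_le_sum_modular_of_luxNorm_lt_prod {ν : Measure X} {pvec : ι → X → ℝ}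
    {h : X → ℝ≥0∞} {F : ι → X → ℝ≥0∞} {v : ι → ℝ≥0∞} {e₁ e₂ : ℝ≥0∞} {s : ℝ} {σ : ι → ℝ}
    (hq : ∀ᵐ x ∂ν, 0 ≤ q x) (hpvec : ∀ i, ∀ᵐ x ∂μ, 0 ≤ pvec i x) (hv0 : ∀ i, v i ≠ 0)
    (hv1 : ∀ i, v i ≤ 1) (hs : 0 < s) (hσ : ∀ i, 0 < σ i) (hsσ : 1 / s ≤ ∑ i, 1 / σ i)
    (he₁ : e₁ ≠ ∞) (he₂0 : e₂ ≠ 0) (he₂ : e₂ ≠ ∞)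
    (hqs : ∀ᵐ x ∂ν, (∏ i, v i) ^ q x ≤ e₁ * (∏ i, v i) ^ s)
    (hpσ : ∀ i, ∀ᵐ x ∂μ, v i ^ σ i ≤ e₂ * v i ^ pvec i x)
    (hh : luxNorm ν q h < ∏ i, v i) (hF : ∀ i, v i < luxNorm μ (pvec i) (F i)) :
    ∫⁻ x, h x ^ q x ∂ν ≤ e₁ * e₂ * ∑ i, ∫⁻ x, F i x ^ pvec i x ∂μ := by
  have hvt : ∀ i, v i ≠ ∞ := fun i => ne_top_of_le_ne_top ENNReal.one_ne_top (hv1 i)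
  have hPt : ∏ i, v i ≠ ∞ := ENNReal.prod_ne_top fun i _ => hvt i
  have hFv : ∀ i, v i ^ σ i ≤ e₂ * ∫⁻ x, F i x ^ pvec i x ∂μ := fun i => by
    rw [← ENNReal.div_le_iff' he₂0 he₂]
    refine le_modular_of_lt_luxNorm (hpvec i) (hv0 i) (hF i)
      (ENNReal.div_ne_top (ENNReal.rpow_ne_top_of_nonneg (hσ i).le (hvt i)) he₂0) ?_
    filter_upwards [hpσ i] with x hx
    rwa [ENNReal.div_le_iff' he₂0 he₂]
  calc ∫⁻ x, h x ^ q x ∂ν ≤ e₁ * (∏ i, v i) ^ s :=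
        modular_le_of_luxNorm_lt hq hPt hh
          (ENNReal.mul_ne_top he₁ (ENNReal.rpow_ne_top_of_nonneg hs.le hPt)) hqs
    _ ≤ e₁ * ∑ i, v i ^ σ i := by
        gcongr
        exact prod_rpow_le_sum_rpow_of_le_one hs hσ hsσ hv1
    _ ≤ e₁ * ∑ i, e₂ * ∫⁻ x, F i x ^ pvec i x ∂μ := by
        gcongr with i
        exact hFv i
    _ = e₁ * e₂ * ∑ i, ∫⁻ x, F i x ^ pvec i x ∂μ := by rw [← Finset.mul_sum, mul_assoc]

end Exponents

section BallEstimate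

variable {X : Type*} [MeasurableSpace X] {d : QuasiMetric X} {μ : Measure X} {A η : ℝ} {x₀ : X}
  {ι : Type*} [Fintype ι] {pvec : ι → X → ℝ} {q : X → ℝ}

theorem rpow_le_ofReal_pow_of_le {P : ℝ≥0∞} {δ a s : ℝ} {M : ℕ} (hδ : 0 < δ) (ha : 0 < a)
    (has : a ≤ s) (hP1 : P ≤ 1) (hP : P ≤ ENNReal.ofReal (δ ^ (M / a : ℝ))) :
    P ^ s ≤ ENNReal.ofReal (δ ^ M) :=
  calc P ^ s ≤ P ^ a := ENNReal.rpow_le_rpow_of_exponent_ge hP1 has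
    _ ≤ ENNReal.ofReal (δ ^ (M / a : ℝ)) ^ a := ENNReal.rpow_le_rpow hP ha.le
    _ = ENNReal.ofReal (δ ^ M) := by
      rw [ENNReal.ofReal_rpow_of_pos (by positivity), ← Real.rpow_mul hδ.le,
        div_mul_cancel₀ _ ha.ne', Real.rpow_natCast]

theorem setLIntegral_rpow_le_of_osc_le {s t : Set X} (hs : MeasurableSet s)
    (ht : MeasurableSet t) (hst : s ⊆ t) (hpvec : ∀ i x, 1 ≤ pvec i x) {δ N K b : ℝ} (hη : 0 ≤ η)
    (hδ : 0 < δ) (hδ1 : δ ≤ 1) (hN : 0 ≤ N)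
    (hosc : ∀ i, ∀ x ∈ t, ∀ y ∈ t, |pvec i x - pvec i y| * Real.log (1 / δ) ≤ K)
    (hq : ∀ᵐ x ∂μ, 0 < q x ∧ q x ≤ b ∧ 1 / q x = ∑ i, 1 / pvec i x - η) {y : X} (hy : y ∈ s)
    (hqy : 0 < q y ∧ q y ≤ b ∧ 1 / q y = ∑ i, 1 / pvec i y - η) {h : X → ℝ≥0∞}
    {F : ι → X → ℝ≥0∞} {v : ι → ℝ≥0∞} (hv1 : ∀ i, v i ≤ 1)
    (hδv : ENNReal.ofReal (δ ^ N) ≤ ∏ i, v i) (hh : luxNorm (μ.restrict t) q h < ∏ i, v i)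
    (hF : ∀ i, v i < luxNorm (μ.restrict s) (pvec i) (F i)) :
    ∫⁻ x in t, h x ^ q x ∂μ ≤
      ENNReal.ofReal (Real.exp (N * (b ^ 2 * (Fintype.card ι * K)))) *
        ENNReal.ofReal (Real.exp (N * K)) * ∑ i, ∫⁻ x in s, F i x ^ pvec i x ∂μ := by
  have hv0 : ∀ i, v i ≠ 0 := fun i =>
    Finset.prod_ne_zero_iff.1 (bot_le.trans_lt hh).ne' i (Finset.mem_univ i)
  have hPv : ∀ i, ∏ j, v j ≤ v i := fun i => by
    simpa using Finset.prod_le_prod_of_subset_of_le_one'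
      (Finset.singleton_subset_iff.2 (Finset.mem_univ i)) fun j _ _ => hv1 j
  refine modular_le_sum_modular_of_luxNorm_lt_prod (s := q y) (σ := fun i => pvec i y)
    ((ae_restrict_of_ae hq).mono fun x hx => hx.1.le)
    (fun i => ae_of_all _ fun x => zero_le_one.trans (hpvec i x)) hv0 hv1 hqy.1
    (fun i => one_pos.trans_le (hpvec i y)) (by linarith [hqy.2.2]) ENNReal.ofReal_ne_top
    (ENNReal.ofReal_pos.2 (Real.exp_pos _)).ne' ENNReal.ofReal_ne_top ?_ (fun i => ?_) hh hF
  · filter_upwards [ae_restrict_of_ae hq, ae_restrict_mem ht] with x hx hxt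
    refine rpow_le_exp_mul_rpow hδ hN hδv (Finset.prod_le_one' fun i _ => hv1 i) ?_
    exact abs_sub_mul_le_of_one_div (fun i => hpvec i x) (fun i => hpvec i y) hx.1 hx.2.1 hqy.1
      hqy.2.1 hx.2.2 hqy.2.2 (Real.log_nonneg ((one_le_div hδ).2 hδ1))
      fun i => hosc i x hxt y (hst hy)
  · filter_upwards [ae_restrict_mem hs] with x hx
    exact rpow_le_exp_mul_rpow hδ hN (hδv.trans (hPv i)) (hv1 i) (hosc i y (hst hy) x (hst hx))

/-- Below the scale `δ ^ (M / a)` the product of the norms is absorbed by `∫_B g`; above it the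
exponents may be replaced by their values at a point `y` of the ball. -/
theorem exists_setLIntegral_ball_rpow_le (hX : IsDoubling d μ) (hA : d.IsTriangleConst A)
    (hη : 0 ≤ η) (hq : IsExpP0 μ q) (hpvec : ∀ i, IsExpP μ (pvec i))
    (hLH : ∀ i, LH d x₀ (pvec i)) (hsum : ∀ᵐ x ∂μ, 1 / q x = ∑ i, 1 / pvec i x - η) {κ : ℝ}
    (hκ : 1 ≤ κ) :
    ∃ (C : ℝ≥0) (g : X → ℝ≥0∞), ∫⁻ x, g x ∂μ < ∞ ∧
      ∀ (c : X) {r : ℝ}, 0 < r → 2 * A * (κ * r) ≤ d c x₀ →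
      ∀ {h : X → ℝ≥0∞} {F : ι → X → ℝ≥0∞},
        (∀ i, luxNorm (μ.restrict (d.ball c r)) (pvec i) (F i) ≤ 1) →
        luxNorm (μ.restrict (d.ball c (κ * r))) q h <
          ∏ i, luxNorm (μ.restrict (d.ball c r)) (pvec i) (F i) / 2 →
        ∫⁻ x in d.ball c (κ * r), h x ^ q x ∂μ ≤
          C * (∫⁻ x in d.ball c r, g x ∂μ + ∑ i, ∫⁻ x in d.ball c r, F i x ^ pvec i x ∂μ) := by
  obtain ⟨a, ha, haq⟩ := hq.exists_ae_gt
  obtain ⟨b, hqb⟩ := hq.exists_ae_lt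
  obtain ⟨K, hK⟩ := exists_forall_osc_mul_log_ballScale_le hLH hA hκ
  obtain ⟨M, g, hgi, hg⟩ := hX.exists_ballScale_pow_le_setLIntegral hA x₀
  set N : ℝ := M / a
  set e₁ : ℝ≥0∞ := ENNReal.ofReal (Real.exp (N * (b ^ 2 * (Fintype.card ι * K))))
  set e₂ : ℝ≥0∞ := ENNReal.ofReal (Real.exp (N * K))
  have he : 1 + e₁ * e₂ ≠ ∞ := by finiteness
  refine ⟨(1 + e₁ * e₂).toNNReal, g, hgi, fun c r hr hfar h F hF hlt => ?_⟩
  rw [ENNReal.coe_toNNReal he]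
  set δ := ballScale d x₀ c r
  set v : ι → ℝ≥0∞ := fun i => luxNorm (μ.restrict (d.ball c r)) (pvec i) (F i) / 2
  have hv1 : ∀ i, v i ≤ 1 := fun i => ENNReal.half_le_self.trans (hF i)
  have hP1 : ∏ i, v i ≤ 1 := Finset.prod_le_one' fun i _ => hv1 i
  have hδ0 : 0 < δ := ballScale_pos x₀ c hr
  have hrκ : r ≤ κ * r := le_mul_of_one_le_left hr.le hκ
  rcases le_total (∏ i, v i) (ENNReal.ofReal (δ ^ N)) with hsmall | hlarge
  · have hfar' : r ≤ d c x₀ := by nlinarith [hA.one_le]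
    calc ∫⁻ x in d.ball c (κ * r), h x ^ q x ∂μ ≤ ENNReal.ofReal (δ ^ M) := by
          refine modular_le_of_luxNorm_lt (ae_of_all _ hq.nonneg)
            (ne_top_of_le_ne_top ENNReal.one_ne_top hP1) hlt ENNReal.ofReal_ne_top ?_
          filter_upwards [ae_restrict_of_ae haq] with x hx
          exact rpow_le_ofReal_pow_of_le hδ0 ha hx.le hP1 hsmall
      _ ≤ ∫⁻ x in d.ball c r, g x ∂μ := hg c hr hfar'
      _ = 1 * ∫⁻ x in d.ball c r, g x ∂μ := (one_mul _).symm
      _ ≤ _ := mul_le_mul' le_self_add le_self_add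
  · have hgood : ∀ᵐ x ∂μ, 0 < q x ∧ q x ≤ b ∧ 1 / q x = ∑ i, 1 / pvec i x - η :=
      hq.ae_pos.and ((hqb.mono fun _ => le_of_lt).and hsum)
    have hvF : ∀ i, v i < luxNorm (μ.restrict (d.ball c r)) (pvec i) (F i) := fun i => by
      have hvi := Finset.prod_ne_zero_iff.1 (bot_le.trans_lt hlt).ne' i (Finset.mem_univ i)
      exact ENNReal.half_lt_self (fun h0 => hvi (by simp [h0]))
        (ne_top_of_le_ne_top ENNReal.one_ne_top (hF i))
    obtain ⟨y, hy, hqy⟩ := hX.exists_mem_ball_of_ae hgood c hr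
    refine (setLIntegral_rpow_le_of_osc_le (hX.measurableSet_ball c hr)
      (hX.measurableSet_ball c (hr.trans_le hrκ)) (d.ball_subset_ball c hrκ)
      (fun i => (hpvec i).one_le) hη hδ0 (ballScale_le_one x₀ c hr) (by positivity)
      (fun i => hK i c hr hfar) hgood hy hqy hv1 hlarge hlt hvF).trans ?_
    exact mul_le_mul' le_add_self le_add_self

end BallEstimate

section Covering

variable {X : Type*} [MeasurableSpace X] {d : QuasiMetric X} {μ : Measure X} {A : ℝ} {x₀ : X}
  {q : X → ℝ} {h : X → ℝ≥0∞} {R : ℝ} {S : Set (X × ℝ)}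

theorem luxNorm_restrict_le_one (hh : ∫⁻ x, h x ^ q x ∂μ ≤ 1) (s : Set X) :
    luxNorm (μ.restrict s) q h ≤ 1 :=
  (luxNorm_restrict_le s).trans
    (luxNorm_le_of_modular_le_one one_ne_zero ENNReal.one_ne_top (by simpa using hh))

theorem setLIntegral_biUnion_central_ball_rpow_le_one (hA : d.IsTriangleConst A)
    (hq : ∀ x, 0 ≤ q x) {Λ κ : ℝ} (hΛ : 0 ≤ Λ) (hκ : A * (Λ + 2 * A * (Λ + 1)) ≤ κ)
    (hpos : ∀ b ∈ S, 0 < b.2) (hR : ∀ b ∈ S, b.2 ≤ R) (hcentral : ∀ b ∈ S, d b.1 x₀ < Λ * b.2)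
    (hh : ∀ b ∈ S, luxNorm (μ.restrict (d.ball b.1 (κ * b.2))) q h < 1) :
    ∫⁻ x in ⋃ b ∈ S, d.ball b.1 b.2, h x ^ q x ∂μ ≤ 1 := by
  rcases S.eq_empty_or_nonempty with rfl | hne
  · simp
  obtain ⟨b, hb, hsub⟩ := hA.exists_biUnion_ball_subset_ball hΛ hne hpos hR hcentral
  have hκb : A * (Λ + 2 * A * (Λ + 1)) * b.2 ≤ κ * b.2 := by
    have := hpos b hb
    gcongr
  refine (lintegral_mono_set (hsub.trans (d.ball_subset_ball _ hκb))).trans ?_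
  simpa only [div_one] using modular_le_one_of_luxNorm_lt (ae_of_all _ hq) (hh b hb)

variable {ι : Type*} [Fintype ι] {η : ℝ} {pvec : ι → X → ℝ} {F : ι → X → ℝ≥0∞}

theorem exists_setLIntegral_biUnion_far_ball_rpow_le (hX : IsDoubling d μ)
    (hA : d.IsTriangleConst A) (hη : 0 ≤ η) (hq : IsExpP0 μ q) (hpvec : ∀ i, IsExpP μ (pvec i))
    (hLH : ∀ i, LH d x₀ (pvec i)) (hsum : ∀ᵐ x ∂μ, 1 / q x = ∑ i, 1 / pvec i x - η) :
    ∃ C : ℝ≥0, ∀ (h : X → ℝ≥0∞) (F : ι → X → ℝ≥0∞) (S : Set (X × ℝ)) (R : ℝ),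
      (∀ i, ∫⁻ x, F i x ^ pvec i x ∂μ ≤ 1) → (∀ b ∈ S, 0 < b.2) → (∀ b ∈ S, b.2 ≤ R) →
      (∀ b ∈ S, 2 * A * (5 * A ^ 2 * b.2) ≤ d b.1 x₀) →
      (∀ b ∈ S, luxNorm (μ.restrict (d.ball b.1 (5 * A ^ 2 * b.2))) q h <
        ∏ i, luxNorm (μ.restrict (d.ball b.1 b.2)) (pvec i) (F i) / 2) →
      ∫⁻ x in ⋃ b ∈ S, d.ball b.1 b.2, h x ^ q x ∂μ ≤ C := by
  obtain ⟨C, g, hg, hC⟩ := exists_setLIntegral_ball_rpow_le hX hA hη hq hpvec hLH hsum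
    (by nlinarith [hA.one_le] : 1 ≤ 5 * A ^ 2)
  have hCt : (C : ℝ≥0∞) * (∫⁻ x, g x ∂μ + Fintype.card ι) ≠ ∞ := by finiteness
  refine ⟨(C * (∫⁻ x, g x ∂μ + Fintype.card ι)).toNNReal, fun h F S R hF hpos hR hfar hh => ?_⟩
  rw [ENNReal.coe_toNNReal hCt]
  obtain ⟨u, huS, hcount, hdisj, hcov⟩ := hX.exists_countable_disjoint_subfamily hA x₀ hpos hR
  have hposu : ∀ b ∈ u, 0 < b.2 := fun b hb => hpos b (huS hb)
  have := hcount.to_subtype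
  calc ∫⁻ x in ⋃ b ∈ S, d.ball b.1 b.2, h x ^ q x ∂μ
      ≤ ∫⁻ x in ⋃ b : u, d.ball b.1.1 (5 * A ^ 2 * b.1.2), h x ^ q x ∂μ := by
        rw [Set.iUnion_coe_set u fun b => d.ball b.1.1 (5 * A ^ 2 * b.1.2)]
        exact lintegral_mono_set hcov
    _ ≤ ∑' b : u, ∫⁻ x in d.ball b.1.1 (5 * A ^ 2 * b.1.2), h x ^ q x ∂μ :=
        lintegral_iUnion_le _ _
    _ ≤ ∑' b : u, C * (∫⁻ x in d.ball b.1.1 b.1.2, g x ∂μ +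
          ∑ i, ∫⁻ x in d.ball b.1.1 b.1.2, F i x ^ pvec i x ∂μ) :=
        ENNReal.tsum_le_tsum fun b => hC _ (hposu b b.2) (hfar b (huS b.2))
          (fun i => luxNorm_restrict_le_one (hF i) _) (hh b (huS b.2))
    _ = C * (∑' b : u, ∫⁻ x in d.ball b.1.1 b.1.2, g x ∂μ +
          ∑ i, ∑' b : u, ∫⁻ x in d.ball b.1.1 b.1.2, F i x ^ pvec i x ∂μ) := by
        rw [ENNReal.tsum_mul_left, ENNReal.tsum_add,
          Summable.tsum_finsetSum fun _ _ => ENNReal.summable]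
    _ ≤ C * (∫⁻ x, g x ∂μ + ∑ _i : ι, 1) := by
        gcongr with i
        · exact hX.tsum_setLIntegral_ball_le hcount hposu hdisj g
        · exact (hX.tsum_setLIntegral_ball_le hcount hposu hdisj _).trans (hF i)
    _ = C * (∫⁻ x, g x ∂μ + Fintype.card ι) := by simp

theorem exists_setLIntegral_biUnion_ball_rpow_le_of_bounded (hX : IsDoubling d μ)
    (hLH : ∀ i, LH d x₀ (pvec i)) (hη : 0 ≤ η) (hq : IsExpP0 μ q) (hpvec : ∀ i, IsExpP μ (pvec i))
    (hsum : ∀ᵐ x ∂μ, 1 / q x = ∑ i, 1 / pvec i x - η) :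
    ∃ (C : ℝ≥0) (κ : ℝ), 1 ≤ κ ∧
      ∀ (h : X → ℝ≥0∞) (F : ι → X → ℝ≥0∞) (S : Set (X × ℝ)) (R : ℝ),
      (∀ i, ∫⁻ x, F i x ^ pvec i x ∂μ ≤ 1) → (∀ b ∈ S, 0 < b.2) → (∀ b ∈ S, b.2 ≤ R) →
      (∀ b ∈ S, luxNorm (μ.restrict (d.ball b.1 (κ * b.2))) q h <
        ∏ i, luxNorm (μ.restrict (d.ball b.1 b.2)) (pvec i) (F i) / 2) →
      ∫⁻ x in ⋃ b ∈ S, d.ball b.1 b.2, h x ^ q x ∂μ ≤ C := by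
  obtain ⟨A, hA⟩ := d.exists_isTriangleConst
  obtain ⟨C, hC⟩ := exists_setLIntegral_biUnion_far_ball_rpow_le hX hA hη hq hpvec hLH hsum
  have hA0 : 0 ≤ A := zero_le_one.trans hA.one_le
  set Λ := 2 * A * (5 * A ^ 2) with hΛ
  set κ := A * (Λ + 2 * A * (Λ + 1))
  have hΛκ : 5 * A ^ 2 ≤ κ := by
    have hAΛ : 5 * A ^ 2 ≤ A * Λ := by nlinarith [hA.one_le, pow_nonneg hA0 2, pow_nonneg hA0 3]
    exact hAΛ.trans (mul_le_mul_of_nonneg_left (le_add_of_nonneg_right (by positivity)) hA0)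
  refine ⟨1 + C, κ, by nlinarith [hA.one_le], fun h F S R hF hpos hR hh => ?_⟩
  have hcov : ⋃ b ∈ S, d.ball b.1 b.2 ⊆ (⋃ b ∈ {b ∈ S | d b.1 x₀ < Λ * b.2}, d.ball b.1 b.2) ∪
      ⋃ b ∈ {b ∈ S | Λ * b.2 ≤ d b.1 x₀}, d.ball b.1 b.2 := by
    rw [← Set.biUnion_union]
    exact Set.biUnion_subset_biUnion_left fun b hb =>
      (lt_or_ge (d b.1 x₀) (Λ * b.2)).imp (⟨hb, ·⟩) (⟨hb, ·⟩)
  push_cast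
  refine (lintegral_mono_set hcov).trans ((lintegral_union_le _ _ _).trans (add_le_add ?_ ?_))
  · refine setLIntegral_biUnion_central_ball_rpow_le_one hA hq.nonneg (by positivity) le_rfl
      (fun b hb => hpos b hb.1) (fun b hb => hR b hb.1) (fun b hb => hb.2)
      fun b hb => (hh b hb.1).trans_le ?_
    exact Finset.prod_le_one' fun i _ =>
      ENNReal.half_le_self.trans (luxNorm_restrict_le_one (hF i) _)
  · refine hC h F _ R hF (fun b hb => hpos b hb.1) (fun b hb => hR b hb.1)
      (fun b hb => by simpa only [hΛ, mul_assoc] using hb.2)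
      fun b hb => (luxNorm_restrict_mono (d.ball_subset_ball _ ?_)).trans_lt (hh b hb.1)
    have := hpos b hb.1
    gcongr

theorem exists_setLIntegral_biUnion_ball_rpow_le (hX : IsDoubling d μ)
    (hLH : ∀ i, LH d x₀ (pvec i)) (hη : 0 ≤ η) (hq : IsExpP0 μ q) (hpvec : ∀ i, IsExpP μ (pvec i))
    (hsum : ∀ᵐ x ∂μ, 1 / q x = ∑ i, 1 / pvec i x - η) :
    ∃ (C : ℝ≥0) (κ : ℝ), 1 ≤ κ ∧ ∀ (h : X → ℝ≥0∞) (F : ι → X → ℝ≥0∞) (S : Set (X × ℝ)),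
      (∀ i, ∫⁻ x, F i x ^ pvec i x ∂μ ≤ 1) → (∀ b ∈ S, 0 < b.2) →
      (∀ b ∈ S, luxNorm (μ.restrict (d.ball b.1 (κ * b.2))) q h <
        ∏ i, luxNorm (μ.restrict (d.ball b.1 b.2)) (pvec i) (F i) / 2) →
      ∫⁻ x in ⋃ b ∈ S, d.ball b.1 b.2, h x ^ q x ∂μ ≤ C := by
  obtain ⟨C, κ, hκ, hC⟩ :=
    exists_setLIntegral_biUnion_ball_rpow_le_of_bounded hX hLH hη hq hpvec hsum
  refine ⟨C, κ, hκ, fun h F S hF hpos hh => ?_⟩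
  have hS : ⋃ b ∈ S, d.ball b.1 b.2 = ⋃ n : ℕ, ⋃ b ∈ {b ∈ S | b.2 ≤ n}, d.ball b.1 b.2 := by
    have hcov : S = ⋃ n : ℕ, {b ∈ S | b.2 ≤ n} := by
      ext b
      simpa using fun _ => exists_nat_ge b.2
    rw [← Set.biUnion_iUnion, ← hcov]
  have hmono : Monotone fun n : ℕ => ⋃ b ∈ {b ∈ S | b.2 ≤ n}, d.ball b.1 b.2 := fun n k hnk =>
    Set.biUnion_subset_biUnion_left fun b hb => ⟨hb.1, hb.2.trans (by exact_mod_cast hnk)⟩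
  rw [hS, setLIntegral_iUnion_of_directed _ hmono.directed_le]
  exact iSup_le fun n => hC h F _ n hF (fun b hb => hpos b hb.1) (fun b hb => hb.2)
    fun b hb => hh b hb.1

end Covering

section Weights

/-- An a.e. measurable function that is positive and finite almost everywhere: a weight in the
sense of `IsWeight`, without local integrability. -/
structure IsPositiveWeight {X : Type*} [MeasurableSpace X] (μ : Measure X) (ω : X → ℝ≥0∞) :
    Prop where
  aemeasurable : AEMeasurable ω μ
  pos_finite : ∀ᵐ x ∂μ, 0 < ω x ∧ ω x < ∞

/-- The norm `‖ω⁻¹ χ_B‖_{p'(·)}` in which the local integrals of functions in `L^{p(·)}(X, ω)` are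
measured. -/
noncomputable def dualNorm {X : Type*} [MeasurableSpace X] (μ : Measure X) (p : X → ℝ)
    (ω : X → ℝ≥0∞) (B : Set X) : ℝ≥0∞ :=
  luxNorm (μ.restrict B) (fun x => (p x).conjExponent) fun x => (ω x)⁻¹

variable {X : Type*} [MeasurableSpace X] {μ : Measure X} {d : QuasiMetric X} {p q : X → ℝ}
  {η : ℝ}

theorem IsWeight.isPositiveWeight {ω : X → ℝ≥0∞} (hω : IsWeight d μ ω) : IsPositiveWeight μ ω :=
  ⟨hω.aemeasurable, hω.pos_finite⟩

theorem dualNorm_mono {ω : X → ℝ≥0∞} {B B' : Set X} (h : B ⊆ B') :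
    dualNorm μ p ω B ≤ dualNorm μ p ω B' :=
  luxNorm_restrict_mono h

theorem setLIntegral_le_luxNorm_mul_dualNorm {ω f : X → ℝ≥0∞} (hp : IsExpP μ p)
    (hω : IsPositiveWeight μ ω) (hf : AEMeasurable f μ) (B : Set X) :
    ∫⁻ x in B, f x ∂μ ≤
      2 * (luxNorm (μ.restrict B) p (fun x => ω x * f x) * dualNorm μ p ω B) := by
  calc ∫⁻ x in B, f x ∂μ = ∫⁻ x in B, (ω x * f x) * (ω x)⁻¹ ∂μ := by
        refine lintegral_congr_ae (ae_restrict_of_ae ?_)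
        filter_upwards [hω.pos_finite] with x hx
        rw [mul_right_comm, ENNReal.mul_inv_cancel hx.1.ne' hx.2.ne, one_mul]
    _ ≤ _ := lintegral_mul_le_luxNorm_mul_luxNorm hp.measurable.aemeasurable
        hp.measurable_conjExponent.aemeasurable
        (ae_of_all _ fun x => one_pos.trans_le (hp.one_le x))
        (ae_restrict_of_ae hp.ae_conjExponent_pos)
        (ae_restrict_of_ae (hp.ae_holderConjugate.mono fun x hx => by
          simpa only [one_div] using hx.inv_add_inv_eq_one))
        (hω.aemeasurable.mul hf).restrict hω.aemeasurable.inv.restrict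

section Product

variable {ι : Type*} [Fintype ι] {pvec : ι → X → ℝ} {ω : ι → X → ℝ≥0∞}

theorem aemeasurable_prod_weight (hω : ∀ i, IsPositiveWeight μ (ω i)) :
    AEMeasurable (fun x => ∏ i, ω i x) μ :=
  Finset.aemeasurable_fun_prod _ fun i _ => (hω i).aemeasurable

theorem luxNorm_prod_weight_ne_zero (hq : IsExpP0 μ q) (hω : ∀ i, IsPositiveWeight μ (ω i))
    {B : Set X} (hB : μ.restrict B ≠ 0) :
    luxNorm (μ.restrict B) q (fun x => ∏ i, ω i x) ≠ 0 := by
  refine luxNorm_ne_zero hB hq.measurable.aemeasurable (ae_restrict_of_ae hq.ae_pos)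
    (aemeasurable_prod_weight hω).restrict (ae_restrict_of_ae ?_)
  filter_upwards [ae_all_iff.2 fun i => (hω i).pos_finite] with x hx
  exact pos_iff_ne_zero.2 (Finset.prod_ne_zero_iff.2 fun i _ => (hx i).1.ne')

theorem ae_prod_mul_prod_inv_eq_one (hω : ∀ i, IsPositiveWeight μ (ω i)) :
    ∀ᵐ x ∂μ, (∏ i, ω i x) * ∏ i, (ω i x)⁻¹ = 1 := by
  filter_upwards [ae_all_iff.2 fun i => (hω i).pos_finite] with x hx
  rw [← Finset.prod_mul_distrib]
  exact Finset.prod_eq_one fun i _ => ENNReal.mul_inv_cancel (hx i).1.ne' (hx i).2.ne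

theorem ae_one_div_add_sum_one_div_conjExponent (hpvec : ∀ i, IsExpP μ (pvec i))
    (hsum : ∀ᵐ x ∂μ, 1 / q x = ∑ i, 1 / pvec i x - η) :
    ∀ᵐ x ∂μ, 1 / q x + ∑ i, 1 / (pvec i x).conjExponent = Fintype.card ι - η := by
  filter_upwards [hsum, ae_all_iff.2 fun i => (hpvec i).ae_holderConjugate] with x hx hconj
  have hinv : ∀ i, 1 / (pvec i x).conjExponent = 1 - 1 / pvec i x := fun i => by
    simpa only [one_div] using eq_sub_of_add_eq' (hconj i).inv_add_inv_eq_one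
  simp only [hinv, hx, Finset.sum_sub_distrib, Finset.sum_const, Finset.card_univ, nsmul_eq_mul,
    mul_one]
  ring

/- Hölder's inequality for `1 = (∏ ωᵢ) ∏ ωᵢ⁻¹`, whose exponents `q, pᵢ'` satisfy
`1 / q + ∑ 1 / pᵢ' = card ι - η`. -/
theorem measure_rpow_le_luxNorm_mul_prod_dualNorm (hη : η < Fintype.card ι) (hq : IsExpP0 μ q)
    (hpvec : ∀ i, IsExpP μ (pvec i)) (hsum : ∀ᵐ x ∂μ, 1 / q x = ∑ i, 1 / pvec i x - η)
    (hω : ∀ i, IsPositiveWeight μ (ω i)) (B : Set X) :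
    μ B ^ (Fintype.card ι - η) ≤ (Fintype.card ι + 1) ^ (Fintype.card ι - η) *
      (luxNorm (μ.restrict B) q (fun x => ∏ i, ω i x) * ∏ i, dualNorm μ (pvec i) (ω i) B) := by
  set s : ℝ := Fintype.card ι - η
  have hs : 0 < s := sub_pos.2 hη
  have hmeas : ∫⁻ x in B, ((∏ i, ω i x) * ∏ i, (ω i x)⁻¹) ^ (1 / s) ∂μ = μ B := by
    rw [← setLIntegral_one]
    refine lintegral_congr_ae (ae_restrict_of_ae ?_)
    filter_upwards [ae_prod_mul_prod_inv_eq_one hω] with x hx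
    rw [hx, ENNReal.one_rpow]
  have holder := lintegral_prod_rpow_le (μ := μ.restrict B) (ι := Option ι) (one_div_pos.2 hs)
    (r := fun k => k.elim q fun i x => (pvec i x).conjExponent)
    (h := fun k => k.elim (fun x => ∏ i, ω i x) fun i x => (ω i x)⁻¹)
    (Option.forall.2 ⟨hq.measurable.aemeasurable,
      fun i => (hpvec i).measurable_conjExponent.aemeasurable⟩)
    (Option.forall.2 ⟨ae_restrict_of_ae hq.ae_pos,
      fun i => ae_restrict_of_ae (hpvec i).ae_conjExponent_pos⟩)
    (ae_restrict_of_ae (by simpa only [Fintype.sum_option, Option.elim, one_div_one_div, s] using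
      ae_one_div_add_sum_one_div_conjExponent hpvec hsum))
    (Option.forall.2 ⟨(aemeasurable_prod_weight hω).restrict,
      fun i => (hω i).aemeasurable.inv.restrict⟩)
  simp only [Fintype.prod_option, Option.elim, Fintype.card_option, Nat.cast_add,
    Nat.cast_one, ENNReal.prod_rpow_of_nonneg (one_div_pos.2 hs).le, hmeas] at holder
  simpa only [dualNorm, ENNReal.mul_rpow_of_nonneg _ _ hs.le, ← ENNReal.rpow_mul,
    one_div_mul_cancel hs.ne', ENNReal.rpow_one] using ENNReal.rpow_le_rpow holder hs.le

end Product

section WeightChar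

variable {m : ℕ} {pvec : Fin m → X → ℝ} {ω : Fin m → X → ℝ≥0∞} {ω₀ : X → ℝ≥0∞}

theorem luxNorm_mul_prod_dualNorm_le_weightChar (hX : IsDoubling d μ) (c : X) {r : ℝ}
    (hr : 0 < r) :
    luxNorm (μ.restrict (d.ball c r)) q ω₀ * ∏ i, dualNorm μ (pvec i) (ω i) (d.ball c r) ≤
      weightChar d μ η pvec q ω ω₀ * μ (d.ball c r) ^ (m - η) := by
  have h0 := (hX.measure_ball_pos c hr).ne'
  have ht := (hX.measure_ball_lt_top c hr).ne
  have hW : μ (d.ball c r) ^ (η - m) * luxNorm (μ.restrict (d.ball c r)) q ω₀ *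
      ∏ i, dualNorm μ (pvec i) (ω i) (d.ball c r) ≤ weightChar d μ η pvec q ω ω₀ :=
    le_iSup_of_le c (le_iSup₂_of_le r hr le_rfl)
  calc _ = μ (d.ball c r) ^ (η - m) * luxNorm (μ.restrict (d.ball c r)) q ω₀ *
        (∏ i, dualNorm μ (pvec i) (ω i) (d.ball c r)) * μ (d.ball c r) ^ (m - η) := by
        rw [mul_right_comm, mul_right_comm (_ ^ _), ← ENNReal.rpow_add _ _ h0 ht]
        simp
    _ ≤ _ := by gcongr

theorem exists_luxNorm_ball_mul_le (hX : IsDoubling d μ) (hη : η < m) (hq : IsExpP0 μ q)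
    (hpvec : ∀ i, IsExpP μ (pvec i)) (hsum : ∀ᵐ x ∂μ, 1 / q x = ∑ i, 1 / pvec i x - η) {κ : ℝ}
    (hκ : 1 ≤ κ) :
    ∃ C : ℝ≥0, ∀ ω : Fin m → X → ℝ≥0∞, (∀ i, IsPositiveWeight μ (ω i)) →
      ∀ (c : X) {r : ℝ}, 0 < r →
        luxNorm (μ.restrict (d.ball c (κ * r))) q (fun x => ∏ i, ω i x) ≤
          C * weightChar d μ η pvec q ω (fun x => ∏ i, ω i x) *
            luxNorm (μ.restrict (d.ball c r)) q (fun x => ∏ i, ω i x) := by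
  obtain ⟨L, hL⟩ := hX.exists_measure_ball_le_pow
  have hs : 0 < m - η := sub_pos.2 hη
  set C₁ : ℝ≥0∞ := (m + 1) ^ (m - η)
  set C₂ : ℝ≥0∞ := ENNReal.ofReal ((2 * κ) ^ L) ^ (m - η)
  have hCt : C₁ * C₂ ≠ ∞ := ENNReal.mul_ne_top
    (ENNReal.rpow_ne_top_of_nonneg hs.le (by finiteness))
    (ENNReal.rpow_ne_top_of_nonneg hs.le (by finiteness))
  refine ⟨(C₁ * C₂).toNNReal, fun ω hω c r hr => ?_⟩
  rw [ENNReal.coe_toNNReal hCt]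
  have hκr : 0 < κ * r := by positivity
  set W := weightChar d μ η pvec q ω fun x => ∏ i, ω i x
  set N := fun s => luxNorm (μ.restrict (d.ball c s)) q fun x => ∏ i, ω i x
  set P := fun s => ∏ i, dualNorm μ (pvec i) (ω i) (d.ball c s)
  set V := fun s => μ (d.ball c s) ^ (m - η)
  have hholder : V r ≤ C₁ * (N r * P r) := by
    simpa only [Fintype.card_fin] using measure_rpow_le_luxNorm_mul_prod_dualNorm
      (by simpa using hη) hq hpvec hsum hω (d.ball c r)
  have hP : P r ≤ P (κ * r) := Finset.prod_le_prod' fun i _ =>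
    dualNorm_mono (d.ball_subset_ball c (le_mul_of_one_le_left hr.le hκ))
  have hV : V (κ * r) ≤ C₂ * V r := by
    rw [← ENNReal.mul_rpow_of_nonneg _ _ hs.le]
    exact ENNReal.rpow_le_rpow (hL c hr hκ) hs.le
  have hV0 : V r ≠ 0 :=
    (ENNReal.rpow_pos (hX.measure_ball_pos c hr) (hX.measure_ball_lt_top c hr).ne).ne'
  have hVt : V r ≠ ∞ := ENNReal.rpow_ne_top_of_nonneg hs.le (hX.measure_ball_lt_top c hr).ne
  rw [← ENNReal.mul_le_mul_iff_left hV0 hVt]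
  calc N (κ * r) * V r ≤ N (κ * r) * (C₁ * (N r * P (κ * r))) := by
        gcongr
        exact hholder.trans (by gcongr)
    _ = C₁ * N r * (N (κ * r) * P (κ * r)) := by ring
    _ ≤ C₁ * N r * (W * (C₂ * V r)) := by
        gcongr _ * ?_
        exact (luxNorm_mul_prod_dualNorm_le_weightChar hX c hκr).trans (by gcongr)
    _ = C₁ * C₂ * W * N r * V r := by ring

theorem fracAverage_eq (η : ℝ) (f : Fin m → X → ℝ) {B : Set X} (h0 : μ B ≠ 0) (ht : μ B ≠ ∞) :
    fracAverage μ η f B = μ B ^ (η - m) * ∏ i, ∫⁻ y in B, ‖f i y‖ₑ ∂μ := by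
  rw [fracAverage, Finset.prod_mul_distrib, ← mul_assoc, ENNReal.rpow_sub _ _ h0 ht,
    div_eq_mul_inv]
  simp [← ENNReal.inv_pow]

theorem fracAverage_ball_mul_luxNorm_le (hX : IsDoubling d μ) (hpvec : ∀ i, IsExpP μ (pvec i))
    (hω : ∀ i, IsPositiveWeight μ (ω i)) {f : Fin m → X → ℝ} (hf : ∀ i, AEMeasurable (f i) μ)
    (c : X) {r : ℝ} (hr : 0 < r) :
    fracAverage μ η f (d.ball c r) * luxNorm (μ.restrict (d.ball c r)) q ω₀ ≤
      2 ^ m * weightChar d μ η pvec q ω ω₀ *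
        ∏ i, wNorm (μ.restrict (d.ball c r)) (pvec i) (ω i) (f i) := by
  set B := d.ball c r
  have h0 : μ B ≠ 0 := (hX.measure_ball_pos c hr).ne'
  have ht : μ B ≠ ∞ := (hX.measure_ball_lt_top c hr).ne
  calc fracAverage μ η f B * luxNorm (μ.restrict B) q ω₀
      ≤ μ B ^ (η - m) * (∏ i, 2 * (wNorm (μ.restrict B) (pvec i) (ω i) (f i) *
          dualNorm μ (pvec i) (ω i) B)) * luxNorm (μ.restrict B) q ω₀ := by
        rw [fracAverage_eq η f h0 ht]
        gcongr with i
        exact setLIntegral_le_luxNorm_mul_dualNorm (hpvec i) (hω i) (hf i).enorm B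
    _ = 2 ^ m * (∏ i, wNorm (μ.restrict B) (pvec i) (ω i) (f i)) * μ B ^ (η - m) *
          (luxNorm (μ.restrict B) q ω₀ * ∏ i, dualNorm μ (pvec i) (ω i) B) := by
        simp only [Finset.prod_mul_distrib, Finset.prod_const, Finset.card_univ, Fintype.card_fin]
        ring
    _ ≤ 2 ^ m * (∏ i, wNorm (μ.restrict B) (pvec i) (ω i) (f i)) * μ B ^ (η - m) *
          (weightChar d μ η pvec q ω ω₀ * μ B ^ (m - η)) := by
        gcongr _ * ?_
        exact luxNorm_mul_prod_dualNorm_le_weightChar hX c hr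
    _ = 2 ^ m * weightChar d μ η pvec q ω ω₀ *
          (∏ i, wNorm (μ.restrict B) (pvec i) (ω i) (f i)) * μ B ^ ((η - m) + (m - η)) := by
        rw [ENNReal.rpow_add _ _ h0 ht]
        ring
    _ = _ := by simp

end WeightChar

end Weights

section Sufficiency

theorem inv_mul_lt_prod_inv_mul_half {ι : Type*} [Fintype ι] {a K : ℝ≥0∞} {N V : ι → ℝ≥0∞}
    (ha : a ≠ 0) (hK : K ≠ ∞) (hN0 : ∀ i, N i ≠ 0) (hNt : ∀ i, N i ≠ ∞) (hVt : ∀ i, V i ≠ ∞)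
    (h : a ≤ K * ∏ i, V i) : (2 * K * ∏ i, 2 * N i)⁻¹ * a < ∏ i, (N i)⁻¹ * V i / 2 := by
  set U := fun i => (N i)⁻¹ * V i / 2
  have hVU : ∀ i, V i = 2 * N i * U i := fun i => by
    calc V i = N i * (N i)⁻¹ * V i := by rw [ENNReal.mul_inv_cancel (hN0 i) (hNt i), one_mul]
      _ = N i * (2 * U i) := by rw [ENNReal.mul_div_cancel two_ne_zero (by simp), mul_assoc]
      _ = _ := by ring
  have hle : a ≤ 2 * K * (∏ i, 2 * N i) * ((∏ i, U i) / 2) := by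
    refine h.trans_eq ?_
    calc K * ∏ i, V i = K * (∏ i, 2 * N i) * ∏ i, U i := by
          simp only [hVU, Finset.prod_mul_distrib, mul_assoc]
      _ = K * (∏ i, 2 * N i) * (2 * ((∏ i, U i) / 2)) := by
          rw [ENNReal.mul_div_cancel two_ne_zero (by simp)]
      _ = _ := by ring
  have hU0 : ∏ i, U i ≠ 0 := fun h0 => ha (nonpos_iff_eq_zero.1 (by simpa [h0] using hle))
  have hK0 : K ≠ 0 := fun h0 => ha (nonpos_iff_eq_zero.1 (by simpa [h0] using hle))
  have hUt : ∏ i, U i ≠ ∞ := ENNReal.prod_ne_top fun i _ => ENNReal.div_ne_top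
    (ENNReal.mul_ne_top (ENNReal.inv_ne_top.2 (hN0 i)) (hVt i)) two_ne_zero
  have hQ0 : 2 * K * ∏ i, 2 * N i ≠ 0 := mul_ne_zero (mul_ne_zero two_ne_zero hK0)
    (Finset.prod_ne_zero_iff.2 fun i _ => mul_ne_zero two_ne_zero (hN0 i))
  have hQt : 2 * K * ∏ i, 2 * N i ≠ ∞ := ENNReal.mul_ne_top (by finiteness)
    (ENNReal.prod_ne_top fun i _ => ENNReal.mul_ne_top (by simp) (hNt i))
  exact ((ENNReal.inv_mul_le_iff hQ0 hQt).2 hle).trans_lt (ENNReal.half_lt_self hU0 hUt)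

variable {X : Type*} [MeasurableSpace X] {μ : Measure X} {d : QuasiMetric X} {q : X → ℝ}
  {η : ℝ} {x₀ : X}

theorem exists_luxNorm_biUnion_ball_le {ι : Type*} [Fintype ι] {pvec : ι → X → ℝ}
    (hX : IsDoubling d μ) (hLH : ∀ i, LH d x₀ (pvec i)) (hη : 0 ≤ η) (hq : IsExpP0 μ q)
    (hpvec : ∀ i, IsExpP μ (pvec i)) (hsum : ∀ᵐ x ∂μ, 1 / q x = ∑ i, 1 / pvec i x - η) :
    ∃ (C : ℝ≥0) (κ : ℝ), 1 ≤ κ ∧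
      ∀ (h : X → ℝ≥0∞) (G : ι → X → ℝ≥0∞) (S : Set (X × ℝ)) (K : ℝ≥0∞),
      (∀ i, AEMeasurable (G i) μ) → (∀ i, luxNorm μ (pvec i) (G i) ≠ ∞) → K ≠ ∞ →
      (∀ b ∈ S, 0 < b.2) → (∀ b ∈ S, luxNorm (μ.restrict (d.ball b.1 (κ * b.2))) q h ≠ 0) →
      (∀ b ∈ S, luxNorm (μ.restrict (d.ball b.1 (κ * b.2))) q h ≤
        K * ∏ i, luxNorm (μ.restrict (d.ball b.1 b.2)) (pvec i) (G i)) →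
      luxNorm (μ.restrict (⋃ b ∈ S, d.ball b.1 b.2)) q h ≤
        C * K * ∏ i, luxNorm μ (pvec i) (G i) := by
  obtain ⟨C₀, κ, hκ, hcover⟩ :=
    exists_setLIntegral_biUnion_ball_rpow_le hX hLH hη hq hpvec hsum
  obtain ⟨a, ha, haq⟩ := hq.exists_ae_gt
  set C₁ : ℝ≥0∞ := 2 * 2 ^ Fintype.card ι * (C₀ + 1) ^ (1 / a)
  have hC₁ : C₁ ≠ ∞ := ENNReal.mul_ne_top (by finiteness)
    (ENNReal.rpow_ne_top_of_nonneg (by positivity) (by finiteness))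
  refine ⟨C₁.toNNReal, κ, hκ, fun h G S K hG hGt hK hpos hh0 hh => ?_⟩
  rw [ENNReal.coe_toNNReal hC₁]
  set N := fun i => luxNorm μ (pvec i) (G i)
  set Q := 2 * K * ∏ i, 2 * N i with hQ
  have hQt : Q ≠ ∞ := ENNReal.mul_ne_top (by finiteness)
    (ENNReal.prod_ne_top fun i _ => ENNReal.mul_ne_top (by simp) (hGt i))
  by_cases hQ0 : Q = 0
  · have hS : S = ∅ := Set.eq_empty_of_forall_notMem fun b hb => hh0 b hb <| nonpos_iff_eq_zero.1 <|
      calc _ ≤ K * ∏ i, luxNorm (μ.restrict (d.ball b.1 b.2)) (pvec i) (G i) := hh b hb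
        _ ≤ K * ∏ i, N i := by gcongr; exact luxNorm_restrict_le _
        _ ≤ Q := by
          rw [hQ]
          gcongr ?_ * ∏ i, ?_ <;> exact le_mul_of_one_le_left' one_le_two
        _ = 0 := hQ0
    simp [hS, luxNorm_zero_measure]
  have hN0 : ∀ i, N i ≠ 0 := fun i hi =>
    hQ0 (by rw [hQ, Finset.prod_eq_zero (Finset.mem_univ i) (by rw [hi, mul_zero]), mul_zero])
  have hmod := hcover (fun x => Q⁻¹ * h x) (fun i x => (N i)⁻¹ * G i x) S
    (fun i => by
      simpa only [ENNReal.div_eq_inv_mul] using modular_div_luxNorm_le_one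
        (hpvec i).measurable.aemeasurable (ae_of_all _ (hpvec i).nonneg) (hG i) (hGt i))
    hpos fun b hb => ?_
  · have hnorm := luxNorm_le_rpow_of_modular_le ha
      (ae_restrict_of_ae (haq.mono fun _ => le_of_lt)) le_add_self (by finiteness)
      (hmod.trans (le_self_add (b := 1)))
    rw [luxNorm_const_mul (ENNReal.inv_ne_zero.2 hQt) (ENNReal.inv_ne_top.2 hQ0),
      ENNReal.inv_mul_le_iff hQ0 hQt] at hnorm
    refine hnorm.trans_eq ?_
    simp only [hQ, C₁, Finset.prod_mul_distrib, Finset.prod_const, Finset.card_univ]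
    ring
  · have hNinv0 : ∀ i, (N i)⁻¹ ≠ 0 := fun i => ENNReal.inv_ne_zero.2 (hGt i)
    have hNinvt : ∀ i, (N i)⁻¹ ≠ ∞ := fun i => ENNReal.inv_ne_top.2 (hN0 i)
    simp only [luxNorm_const_mul (ENNReal.inv_ne_zero.2 hQt) (ENNReal.inv_ne_top.2 hQ0),
      luxNorm_const_mul (hNinv0 _) (hNinvt _)]
    exact inv_mul_lt_prod_inv_mul_half (hh0 b hb) hK hN0 hGt
      (fun i => ne_top_of_le_ne_top (hGt i) (luxNorm_restrict_le _)) (hh b hb)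

variable {m : ℕ} {pvec : Fin m → X → ℝ}

theorem setOf_lt_fracMaximal (f : Fin m → X → ℝ) (t : ℝ≥0∞) :
    {x | t < fracMaximal d μ η f x} =
      ⋃ b ∈ {b : X × ℝ | 0 < b.2 ∧ t < fracAverage μ η f (d.ball b.1 b.2)}, d.ball b.1 b.2 := by
  ext x
  simp only [fracMaximal, Set.mem_ofPred_eq, lt_iSup_iff, Set.mem_iUnion, Prod.exists, exists_prop]
  tauto

theorem exists_fracAverage_mul_luxNorm_ball_le (hX : IsDoubling d μ) (hη : η < m)
    (hq : IsExpP0 μ q) (hpvec : ∀ i, IsExpP μ (pvec i))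
    (hsum : ∀ᵐ x ∂μ, 1 / q x = ∑ i, 1 / pvec i x - η) {κ : ℝ} (hκ : 1 ≤ κ) :
    ∃ C : ℝ≥0, ∀ ω : Fin m → X → ℝ≥0∞, (∀ i, IsPositiveWeight μ (ω i)) →
      ∀ f : Fin m → X → ℝ, (∀ i, AEMeasurable (f i) μ) → ∀ (c : X) {r : ℝ}, 0 < r →
        fracAverage μ η f (d.ball c r) *
            luxNorm (μ.restrict (d.ball c (κ * r))) q (fun x => ∏ i, ω i x) ≤
          C * weightChar d μ η pvec q ω (fun x => ∏ i, ω i x) ^ 2 *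
            ∏ i, wNorm (μ.restrict (d.ball c r)) (pvec i) (ω i) (f i) := by
  obtain ⟨C, hC⟩ := exists_luxNorm_ball_mul_le hX hη hq hpvec hsum hκ
  refine ⟨2 ^ m * C, fun ω hω f hf c r hr => ?_⟩
  set W := weightChar d μ η pvec q ω fun x => ∏ i, ω i x
  calc _ ≤ fracAverage μ η f (d.ball c r) *
        (C * W * luxNorm (μ.restrict (d.ball c r)) q fun x => ∏ i, ω i x) := by
        gcongr
        exact hC ω hω c hr
    _ = C * W * (fracAverage μ η f (d.ball c r) *
          luxNorm (μ.restrict (d.ball c r)) q fun x => ∏ i, ω i x) := by ring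
    _ ≤ C * W * (2 ^ m * W * ∏ i, wNorm (μ.restrict (d.ball c r)) (pvec i) (ω i) (f i)) := by
        gcongr _ * ?_
        exact fracAverage_ball_mul_luxNorm_le hX hpvec hω hf c hr
    _ = _ := by
        push_cast
        ring

theorem exists_weakBoundWith (hX : IsDoubling d μ) (hLH : ∀ i, LH d x₀ (pvec i)) (hη : 0 ≤ η)
    (hηm : η < m) (hq : IsExpP0 μ q) (hpvec : ∀ i, IsExpP μ (pvec i))
    (hsum : ∀ᵐ x ∂μ, 1 / q x = ∑ i, 1 / pvec i x - η) :
    ∃ C : ℝ≥0, ∀ ω : Fin m → X → ℝ≥0∞, (∀ i, IsPositiveWeight μ (ω i)) → ∀ W : ℝ≥0,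
      weightChar d μ η pvec q ω (fun x => ∏ i, ω i x) ≤ W →
        WeakBoundWith d μ η pvec q ω (fun x => ∏ i, ω i x) (C * W ^ 2) := by
  obtain ⟨C₁, κ, hκ, hcover⟩ := exists_luxNorm_biUnion_ball_le hX hLH hη hq hpvec hsum
  obtain ⟨C₂, hball⟩ := exists_fracAverage_mul_luxNorm_ball_le hX hηm hq hpvec hsum hκ
  refine ⟨C₁ * C₂, fun ω hω W hW f hf => iSup₂_le fun t ht => ?_⟩
  have ht0 : (t : ℝ≥0∞) ≠ 0 := by exact_mod_cast ht.ne'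
  rw [setOf_lt_fracMaximal]
  calc _ ≤ C₁ * (C₂ * W ^ 2) * ∏ i, wNorm μ (pvec i) (ω i) (f i) := ?_
    _ = _ := by
        push_cast
        ring
  refine hcover _ _ _ _ (fun i => (hω i).aemeasurable.mul (hf i).1.enorm)
    (fun i => (hf i).2.ne) (by finiteness) (fun b hb => hb.1) (fun b hb => ?_) fun b hb => ?_
  · rw [luxNorm_const_mul ht0 ENNReal.coe_ne_top]
    exact mul_ne_zero ht0 <| luxNorm_prod_weight_ne_zero hq hω <|
      hX.restrict_ball_ne_zero b.1 (mul_pos (one_pos.trans_le hκ) hb.1)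
  · rw [luxNorm_const_mul ht0 ENNReal.coe_ne_top]
    calc _ ≤ fracAverage μ η f (d.ball b.1 b.2) *
          luxNorm (μ.restrict (d.ball b.1 (κ * b.2))) q (fun x => ∏ i, ω i x) := by
          gcongr
          exact hb.2.le
      _ ≤ _ := hball ω hω f (fun i => (hf i).1) b.1 hb.1
      _ ≤ _ := by
          gcongr
          exact le_rfl

end Sufficiency

section Duality

variable {X : Type*} [MeasurableSpace X] {μ : Measure X} {p r : X → ℝ} {g : X → ℝ≥0∞}

theorem exists_lt_luxNorm_min (hr : AEMeasurable r μ) (hr0 : ∀ᵐ x ∂μ, 0 ≤ r x)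
    (hg : AEMeasurable g μ) {L : ℝ≥0∞} (hL : L < luxNorm μ r g) :
    ∃ n : ℕ, L < luxNorm μ r (fun x => min (g x) n) := by
  by_contra! hc
  refine hL.not_ge (le_of_forall_gt_imp_ge_of_dense fun s hs => ?_)
  rcases eq_or_ne s ∞ with rfl | hst
  · exact le_top
  have hs0 : s ≠ 0 := (bot_le.trans_lt hs).ne'
  refine luxNorm_le_of_modular_le_one hs0 hst ?_
  refine le_of_tendsto' (lintegral_tendsto_of_tendsto_of_monotone
    (f := fun (n : ℕ) x => (min (g x) n / s) ^ r x)
    (fun n => ((hg.min aemeasurable_const).div_const _).pow hr) ?_ (ae_of_all _ fun x => ?_))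
    fun n => modular_le_one_of_luxNorm_lt hr0 ((hc n).trans_lt hs)
  · filter_upwards [hr0] with x hx n k hnk
    exact ENNReal.rpow_le_rpow (by gcongr) hx
  · have hmin : Tendsto (fun n : ℕ => min (g x) n) atTop (𝓝 (g x)) := by
      simpa using (tendsto_const_nhds (x := g x)).min ENNReal.tendsto_nat_nhds_top
    exact (ENNReal.continuous_rpow_const.tendsto _).comp
      (ENNReal.Tendsto.div_const hmin (Or.inr hs0))

theorem luxNorm_ne_top_of_le [IsFiniteMeasure μ] {a b : ℝ} (ha : 0 < a) (hra : ∀ᵐ x ∂μ, a ≤ r x)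
    (hrb : ∀ᵐ x ∂μ, r x ≤ b) {M : ℝ≥0∞} (hM : M ≠ ∞) (hg : ∀ x, g x ≤ M) :
    luxNorm μ r g ≠ ∞ := by
  set D : ℝ≥0∞ := (M + 1) ^ max b 0 * μ Set.univ + 1
  have hDt : D ≠ ∞ := by
    have : (M + 1) ^ max b 0 ≠ ∞ :=
      ENNReal.rpow_ne_top_of_nonneg (le_max_right b 0) (by finiteness)
    finiteness
  refine ne_top_of_le_ne_top (ENNReal.rpow_ne_top_of_nonneg (by positivity) hDt)
    (luxNorm_le_rpow_of_modular_le ha hra le_add_self hDt (le_trans ?_ le_self_add))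
  calc ∫⁻ x, g x ^ r x ∂μ ≤ ∫⁻ _, (M + 1) ^ max b 0 ∂μ := by
        refine lintegral_mono_ae ?_
        filter_upwards [hra, hrb] with x hax hxb
        calc g x ^ r x ≤ (M + 1) ^ r x :=
              ENNReal.rpow_le_rpow ((hg x).trans le_self_add) (ha.le.trans hax)
          _ ≤ (M + 1) ^ max b 0 :=
              ENNReal.rpow_le_rpow_of_exponent_le le_add_self (hxb.trans (le_max_left b 0))
    _ = _ := lintegral_const _

theorem half_rpow_le_modular_div_luxNorm (hr0 : ∀ᵐ x ∂μ, 0 ≤ r x) {b : ℝ}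
    (hb : ∀ᵐ x ∂μ, r x ≤ b) (h0 : luxNorm μ r g ≠ 0) (ht : luxNorm μ r g ≠ ∞) :
    (2⁻¹ : ℝ≥0∞) ^ b ≤ ∫⁻ x, (g x / luxNorm μ r g) ^ r x ∂μ := by
  have hnorm : luxNorm μ r (fun x => g x / luxNorm μ r g) = 1 := by
    simp only [ENNReal.div_eq_inv_mul]
    rw [luxNorm_const_mul (ENNReal.inv_ne_zero.2 ht) (ENNReal.inv_ne_top.2 h0),
      ENNReal.inv_mul_cancel h0 ht]
  refine le_modular_of_lt_luxNorm (r := 2⁻¹) hr0 (by simp) (hnorm ▸ ENNReal.one_half_lt_one)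
    (ENNReal.rpow_ne_top_of_ne_zero (by simp) (by simp)) ?_
  filter_upwards [hb] with x hx
  exact ENNReal.rpow_le_rpow_of_exponent_ge (by simp) hx

theorem exists_luxNorm_le_lintegral_mul (hpr : ∀ᵐ x ∂μ, (p x).HolderConjugate (r x))
    (hr : AEMeasurable r μ) {b : ℝ} (hb : ∀ᵐ x ∂μ, r x ≤ b) (hg : AEMeasurable g μ)
    (ht : luxNorm μ r g ≠ ∞) :
    ∃ h : X → ℝ≥0∞, AEMeasurable h μ ∧ ∫⁻ x, h x ^ p x ∂μ ≤ 1 ∧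
      2⁻¹ ^ b * luxNorm μ r g ≤ ∫⁻ x, h x * g x ∂μ := by
  set N := luxNorm μ r g
  have hr0 : ∀ᵐ x ∂μ, 0 ≤ r x := hpr.mono fun x hx => hx.symm.nonneg
  rcases eq_or_ne N 0 with h0 | h0
  · refine ⟨0, aemeasurable_const, ?_, by simp [h0]⟩
    refine (lintegral_eq_zero_of_ae_eq_zero ?_).trans_le zero_le_one
    filter_upwards [hpr] with x hx
    exact ENNReal.zero_rpow_of_pos hx.pos
  refine ⟨fun x => (g x / N) ^ (r x - 1), (hg.div_const _).pow (hr.sub_const 1), ?_, ?_⟩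
  · refine (lintegral_congr_ae ?_).trans_le (modular_div_luxNorm_le_one hr hr0 hg ht)
    filter_upwards [hpr] with x hx
    rw [← ENNReal.rpow_mul, hx.symm.sub_one_mul_conj]
  · calc 2⁻¹ ^ b * N ≤ (∫⁻ x, (g x / N) ^ r x ∂μ) * N := by
          gcongr
          exact half_rpow_le_modular_div_luxNorm hr0 hb h0 ht
      _ = ∫⁻ x, (g x / N) ^ r x * N ∂μ := (lintegral_mul_const' _ _ ht).symm
      _ = ∫⁻ x, (g x / N) ^ (r x - 1) * g x ∂μ := by
          refine lintegral_congr_ae ?_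
          filter_upwards [hpr] with x hx
          calc (g x / N) ^ r x * N = (g x / N) ^ ((r x - 1) + 1) * N := by rw [sub_add_cancel]
            _ = (g x / N) ^ (r x - 1) * (g x / N * N) := by
                rw [ENNReal.rpow_add_of_nonneg _ _ hx.symm.sub_one_pos.le zero_le_one,
                  ENNReal.rpow_one, mul_assoc]
            _ = _ := by rw [ENNReal.div_mul_cancel h0 ht]

theorem exists_mul_le_lintegral_mul_of_lt_luxNorm [IsFiniteMeasure μ]
    (hpr : ∀ᵐ x ∂μ, (p x).HolderConjugate (r x)) (hr : AEMeasurable r μ) {b : ℝ}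
    (hb : ∀ᵐ x ∂μ, r x ≤ b) (hg : AEMeasurable g μ) {L : ℝ≥0∞} (hL : L < luxNorm μ r g) :
    ∃ h : X → ℝ≥0∞, AEMeasurable h μ ∧ ∫⁻ x, h x ^ p x ∂μ ≤ 1 ∧
      2⁻¹ ^ b * L ≤ ∫⁻ x, h x * g x ∂μ := by
  obtain ⟨n, hn⟩ := exists_lt_luxNorm_min hr (hpr.mono fun x hx => hx.symm.nonneg) hg hL
  obtain ⟨h, hm, hle, hint⟩ := exists_luxNorm_le_lintegral_mul hpr hr hb
    (hg.min aemeasurable_const) (luxNorm_ne_top_of_le one_pos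
      (hpr.mono fun x hx => hx.symm.lt.le) hb (ENNReal.natCast_ne_top n) fun x => min_le_right _ _)
  refine ⟨h, hm, hle, ?_⟩
  calc 2⁻¹ ^ b * L ≤ 2⁻¹ ^ b * luxNorm μ r (fun x => min (g x) n) := by gcongr
    _ ≤ ∫⁻ x, h x * min (g x) n ∂μ := hint
    _ ≤ ∫⁻ x, h x * g x ∂μ := by
        gcongr with x
        exact min_le_left _ _

theorem IsExpP.exists_wNorm_le_one_mul_le_setLIntegral (hp : IsExpP μ p) :
    ∃ a : ℝ≥0, 0 < a ∧ ∀ ω : X → ℝ≥0∞, IsPositiveWeight μ ω →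
      ∀ B, MeasurableSet B → μ B ≠ ∞ → ∀ L < dualNorm μ p ω B,
        ∃ f : X → ℝ, AEMeasurable f μ ∧ wNorm μ p ω f ≤ 1 ∧ a * L ≤ ∫⁻ x in B, ‖f x‖ₑ ∂μ := by
  obtain ⟨b, hb⟩ := hp.exists_ae_conjExponent_le
  have hat : (2⁻¹ : ℝ≥0∞) ^ b ≠ ∞ := ENNReal.rpow_ne_top_of_ne_zero (by simp) (by simp)
  refine ⟨((2⁻¹ : ℝ≥0∞) ^ b).toNNReal,
    ENNReal.toNNReal_pos (ENNReal.rpow_pos (by simp) (by simp)).ne' hat,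
    fun ω hω B hB hBt L hL => ?_⟩
  rw [ENNReal.coe_toNNReal hat]
  have : IsFiniteMeasure (μ.restrict B) := isFiniteMeasure_restrict.2 hBt
  obtain ⟨h, hm, hle, hint⟩ := exists_mul_le_lintegral_mul_of_lt_luxNorm
    (ae_restrict_of_ae hp.ae_holderConjugate) hp.measurable_conjExponent.aemeasurable
    (ae_restrict_of_ae hb) hω.aemeasurable.inv.restrict hL
  have hfin : ∀ᵐ x ∂μ.restrict B, ‖(h x * (ω x)⁻¹).toReal‖ₑ = h x * (ω x)⁻¹ := by
    filter_upwards [ae_lt_top' (hm.pow hp.measurable.aemeasurable)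
      (hle.trans_lt ENNReal.one_lt_top).ne, ae_restrict_of_ae hω.pos_finite] with x hx hωx
    refine Real.enorm_toReal (ENNReal.mul_ne_top ?_ (ENNReal.inv_ne_top.2 hωx.1.ne'))
    intro htop
    rw [htop, ENNReal.top_rpow_of_pos (one_pos.trans_le (hp.one_le x))] at hx
    exact hx.ne rfl
  refine ⟨B.indicator fun x => (h x * (ω x)⁻¹).toReal, ?_, ?_, ?_⟩
  · rw [aemeasurable_indicator_iff hB]
    exact (hm.mul hω.aemeasurable.inv.restrict).ennreal_toReal
  · refine luxNorm_le_of_modular_le_one one_ne_zero ENNReal.one_ne_top (le_of_eq_of_le ?_ hle)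
    rw [← lintegral_indicator hB]
    refine lintegral_congr_ae ?_
    filter_upwards [(ae_restrict_iff' hB).1 hfin, hω.pos_finite] with x hx hωx
    by_cases hxB : x ∈ B
    · simp only [Set.indicator_of_mem hxB, hx hxB, div_one]
      rw [mul_left_comm, ENNReal.mul_inv_cancel hωx.1.ne' hωx.2.ne, mul_one]
    · simp only [Set.indicator_of_notMem hxB, enorm_zero, mul_zero, div_one,
        ENNReal.zero_rpow_of_pos (one_pos.trans_le (hp.one_le x))]
  · refine hint.trans_eq (lintegral_congr_ae ?_)
    filter_upwards [hfin, ae_restrict_mem hB] with x hx hxB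
    simp only [Set.indicator_of_mem hxB, hx, Pi.inv_apply]

end Duality

section Necessity

theorem mul_prod_le_of_forall_lt {ι : Type*} (s : Finset ι) (b : ι → ℝ≥0∞) {C : ℝ≥0∞} (K : ℝ≥0∞)
    (h : ∀ L : ι → ℝ≥0∞, (∀ i ∈ s, L i < b i) → K * ∏ i ∈ s, L i ≤ C) :
    K * ∏ i ∈ s, b i ≤ C := by
  classical
  induction s using Finset.cons_induction generalizing K with
  | empty => simpa using h 0 (by simp)
  | cons j s hj ih =>
    rw [Finset.prod_cons, ← mul_assoc]
    refine ih _ fun L hL => ?_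
    rw [mul_right_comm]
    refine ENNReal.mul_le_of_forall_lt fun a ha c hc => ?_
    have hne : ∀ i ∈ s, i ≠ j := fun i hi hij => hj (hij ▸ hi)
    have hle := h (Function.update L j c) (by
      rw [Finset.forall_mem_cons]
      refine ⟨by rwa [Function.update_self], fun i hi => ?_⟩
      rw [Function.update_of_ne (hne i hi)]
      exact hL i hi)
    rw [Finset.prod_cons, Function.update_self,
      Finset.prod_congr rfl fun i hi => Function.update_of_ne (hne i hi) c L] at hle
    calc a * c ≤ (K * ∏ i ∈ s, L i) * c := by gcongr
      _ = K * (c * ∏ i ∈ s, L i) := by ring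
      _ ≤ C := hle

variable {X : Type*} [MeasurableSpace X] {μ : Measure X} {d : QuasiMetric X} {m : ℕ} {η : ℝ}
  {pvec : Fin m → X → ℝ} {q : X → ℝ}

theorem WeakBoundWith.fracAverage_mul_luxNorm_le {ω : Fin m → X → ℝ≥0∞} {ω₀ : X → ℝ≥0∞} {K : ℝ≥0}
    (h : WeakBoundWith d μ η pvec q ω ω₀ K) {f : Fin m → X → ℝ} (hf : ∀ i, AEMeasurable (f i) μ)
    (hf1 : ∀ i, wNorm μ (pvec i) (ω i) (f i) ≤ 1) (c : X) {r : ℝ} (hr : 0 < r) :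
    fracAverage μ η f (d.ball c r) * luxNorm (μ.restrict (d.ball c r)) q ω₀ ≤ K := by
  refine ENNReal.mul_le_of_forall_lt fun t ht s hs => ?_
  rcases eq_or_ne t 0 with rfl | ht0
  · simp
  lift t to ℝ≥0 using ht.ne_top
  have hsub : d.ball c r ⊆ {x | (t : ℝ≥0∞) < fracMaximal d μ η f x} := fun x hx =>
    ht.trans_le (le_iSup₂_of_le c r (le_iSup₂_of_le hr hx le_rfl))
  calc (t : ℝ≥0∞) * s ≤ t * luxNorm (μ.restrict (d.ball c r)) q ω₀ := by gcongr
    _ = luxNorm (μ.restrict (d.ball c r)) q (fun x => t * ω₀ x) :=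
        (luxNorm_const_mul ht0 ENNReal.coe_ne_top).symm
    _ ≤ luxNorm (μ.restrict {x | (t : ℝ≥0∞) < fracMaximal d μ η f x}) q (fun x => t * ω₀ x) :=
        luxNorm_restrict_mono hsub
    _ ≤ weakNorm μ q ω₀ (fracMaximal d μ η f) :=
        le_iSup₂_of_le t (pos_iff_ne_zero.2 (by exact_mod_cast ht0)) le_rfl
    _ ≤ K * ∏ i, wNorm μ (pvec i) (ω i) (f i) :=
        h f fun i => ⟨hf i, (hf1 i).trans_lt ENNReal.one_lt_top⟩
    _ ≤ K := mul_le_of_le_one_right' (Finset.prod_le_one' fun i _ => hf1 i)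

theorem exists_weightChar_le_mul_of_weakBoundWith (hX : IsDoubling d μ)
    (hpvec : ∀ i, IsExpP μ (pvec i)) :
    ∃ C : ℝ≥0, 0 < C ∧ ∀ ω : Fin m → X → ℝ≥0∞, (∀ i, IsPositiveWeight μ (ω i)) →
      ∀ (ω₀ : X → ℝ≥0∞) (K : ℝ≥0), WeakBoundWith d μ η pvec q ω ω₀ K →
        weightChar d μ η pvec q ω ω₀ ≤ C * K := by
  choose a ha htest using fun i => (hpvec i).exists_wNorm_le_one_mul_le_setLIntegral
  have hA : 0 < ∏ i, a i := Finset.prod_pos fun i _ => ha i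
  have hA0 : (↑(∏ i, a i) : ℝ≥0∞) ≠ 0 := by exact_mod_cast hA.ne'
  refine ⟨(∏ i, a i)⁻¹, inv_pos.2 hA, fun ω hω ω₀ K hK =>
    iSup_le fun c => iSup₂_le fun r hr => mul_prod_le_of_forall_lt _ _ _ fun L hL => ?_⟩
  set B := d.ball c r
  have ht : μ B ≠ ∞ := (hX.measure_ball_lt_top c hr).ne
  choose f hfm hf1 hfL using fun i => htest i (ω i) (hω i) B (hX.measurableSet_ball c hr) ht (L i)
    (hL i (Finset.mem_univ i))
  rw [ENNReal.coe_inv hA.ne', ← ENNReal.div_eq_inv_mul,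
    ENNReal.le_div_iff_mul_le (Or.inl hA0) (Or.inl ENNReal.coe_ne_top)]
  calc _ = μ B ^ (η - m) * (∏ i, a i * L i) * luxNorm (μ.restrict B) q ω₀ := by
        rw [Finset.prod_mul_distrib, ENNReal.ofNNReal_finsetProd]
        ring
    _ ≤ μ B ^ (η - m) * (∏ i, ∫⁻ x in B, ‖f i x‖ₑ ∂μ) * luxNorm (μ.restrict B) q ω₀ := by
        gcongr with i
        exact hfL i
    _ ≤ K := by
        rw [← fracAverage_eq η f (hX.measure_ball_pos c hr).ne' ht]
        exact hK.fracAverage_mul_luxNorm_le hfm hf1 c hr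

theorem exists_weightChar_le_mul_weakOpNorm (hX : IsDoubling d μ)
    (hpvec : ∀ i, IsExpP μ (pvec i)) :
    ∃ C : ℝ≥0, 0 < C ∧ ∀ ω : Fin m → X → ℝ≥0∞, (∀ i, IsPositiveWeight μ (ω i)) →
      ∀ ω₀ : X → ℝ≥0∞, weightChar d μ η pvec q ω ω₀ ≤ C * weakOpNorm d μ η pvec q ω ω₀ := by
  obtain ⟨C, hC0, hC⟩ :=
    exists_weightChar_le_mul_of_weakBoundWith (η := η) (q := q) hX hpvec
  have hC0' : (C : ℝ≥0∞) ≠ 0 := by exact_mod_cast hC0.ne'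
  refine ⟨C, hC0, fun ω hω ω₀ => ?_⟩
  rw [← ENNReal.inv_mul_le_iff hC0' ENNReal.coe_ne_top]
  exact le_iInf₂ fun K hK =>
    (ENNReal.inv_mul_le_iff hC0' ENNReal.coe_ne_top).2 (hC ω hω ω₀ K hK)

theorem WeakBounded.weakOpNorm_lt_top {ω : Fin m → X → ℝ≥0∞} {ω₀ : X → ℝ≥0∞}
    (h : WeakBounded d μ η pvec q ω ω₀) : weakOpNorm d μ η pvec q ω ω₀ < ∞ := by
  obtain ⟨K, hK⟩ := h
  exact (iInf₂_le K hK).trans_lt ENNReal.coe_lt_top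

end Necessity

end VarWeights

theorem theorem1p4_general {X : Type*} [MeasurableSpace X] {d : QuasiMetric X} {μ : Measure X}
    (hX : IsDoubling d μ) {x₀ : X} {m : ℕ} {η : ℝ} (hη : 0 ≤ η) (hηm : η < m)
    {pvec : Fin m → X → ℝ} {q : X → ℝ} (hpvec : ∀ i, IsExpP μ (pvec i))
    (hLH : ∀ i, LH d x₀ (pvec i)) (hq : IsExpP0 μ q)
    (hpq : ∀ᵐ x ∂μ, 1 / q x = ∑ i, 1 / pvec i x - η) :
    (∀ ω : Fin m → X → ℝ≥0∞, (∀ i, IsPositiveWeight μ (ω i)) →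
      (WeakBounded d μ η pvec q ω (fun x => ∏ i, ω i x) ↔
        MemA d μ η pvec q ω (fun x => ∏ i, ω i x))) ∧
    (∃ C : ℝ≥0, 0 < C ∧ ∀ ω : Fin m → X → ℝ≥0∞, (∀ i, IsPositiveWeight μ (ω i)) →
      weightChar d μ η pvec q ω (fun x => ∏ i, ω i x) ≤
        C * weakOpNorm d μ η pvec q ω (fun x => ∏ i, ω i x)) ∧
    (∀ ω : Fin m → X → ℝ≥0∞, (∀ i, IsPositiveWeight μ (ω i)) →
      MemA d μ η pvec q ω (fun x => ∏ i, ω i x) →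
        weakOpNorm d μ η pvec q ω (fun x => ∏ i, ω i x) < ∞) := by
  obtain ⟨C, hC0, hC⟩ := exists_weightChar_le_mul_weakOpNorm (η := η) (q := q) hX hpvec
  obtain ⟨K, hK⟩ := exists_weakBoundWith hX hLH hη hηm hq hpvec hpq
  have hbdd : ∀ ω : Fin m → X → ℝ≥0∞, (∀ i, IsPositiveWeight μ (ω i)) →
      MemA d μ η pvec q ω (fun x => ∏ i, ω i x) →
        WeakBounded d μ η pvec q ω (fun x => ∏ i, ω i x) := fun ω hω hA =>
    ⟨_, hK ω hω _ (ENNReal.coe_toNNReal hA.ne).ge⟩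
  refine ⟨fun ω hω => ⟨fun h => ?_, hbdd ω hω⟩, ⟨C, hC0, fun ω hω => hC ω hω _⟩,
    fun ω hω hA => (hbdd ω hω hA).weakOpNorm_lt_top⟩
  exact (hC ω hω _).trans_lt (ENNReal.mul_lt_top ENNReal.coe_lt_top h.weakOpNorm_lt_top)

theorem theorem1p4 {X : Type*} [MeasurableSpace X] (d : QuasiMetric X) (μ : Measure X)
    (hX : IsHomogeneousType d μ) (x₀ : X)
    (m : ℕ) (η : ℝ) (hη : 0 ≤ η) (hηm : η < m)
    (pvec : Fin m → X → ℝ) (p q : X → ℝ)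
    (hpvec : ∀ i, IsExpP μ (pvec i)) (hLH : ∀ i, LH d x₀ (pvec i))
    (hp : ∀ x, 1 / p x = ∑ i, 1 / pvec i x)
    (hq : IsExpP0 μ q) (hpq : ∀ x, 1 / p x - 1 / q x = η) :
    (∀ ω : Fin m → X → ℝ≥0∞, (∀ i, IsWeight d μ (ω i)) →
      (WeakBounded d μ η pvec q ω (fun x => ∏ i, ω i x) ↔
        MemA d μ η pvec q ω (fun x => ∏ i, ω i x))) ∧
    (∃ C : ℝ≥0, 0 < C ∧ ∀ ω : Fin m → X → ℝ≥0∞, (∀ i, IsWeight d μ (ω i)) →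
      weightChar d μ η pvec q ω (fun x => ∏ i, ω i x) ≤
        C * weakOpNorm d μ η pvec q ω (fun x => ∏ i, ω i x)) ∧
    (∀ ω : Fin m → X → ℝ≥0∞, (∀ i, IsWeight d μ (ω i)) →
      MemA d μ η pvec q ω (fun x => ∏ i, ω i x) →
        weakOpNorm d μ η pvec q ω (fun x => ∏ i, ω i x) < ∞) := by
  obtain ⟨hiff, ⟨C, hC0, hC⟩, hfin⟩ := theorem1p4_general hX.isDoubling hη hηm hpvec hLH hq
    (ae_of_all μ fun x => by rw [← hp x, ← hpq x]; ring)
  exact ⟨fun ω hω => hiff ω fun i => (hω i).isPositiveWeight,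
    ⟨C, hC0, fun ω hω => hC ω fun i => (hω i).isPositiveWeight⟩,
    fun ω hω => hfin ω fun i => (hω i).isPositiveWeight⟩
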